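/- **Setting.** For integers $0\le i\le k$, put $\|f\|_{C^k(\Omega)}=\max_{0\le i\le k}\sup_{x\in\Omega}\|d^if(x)\|_{op}$, and $\log_+x=\max(\log x,0)$. Let $\alpha\ge 0$ and $\beta\ge\alpha+1$ be integers. Let $M\subset\mathbb R^D$ be a compact $\beta$-smooth submanifold without boundary, of dimension $d\ge 3$, of reach $\tau>\tau_{\min}>0$ and with $\operatorname{diam}M\le 1$. For $y\in M$ let $\Phi_y$, defined on the ball $B_{T_yM}(0,\tau/8)$, be the inverse of the restriction to $M\cap B(y,\tau/4)$ of the orthogonal projection onto $T_yM$ (with origin at $y$), and suppose $\|\Phi_y\|_{C^\beta(B_{T_yM}(0,\tau/8))}\le L_M$ for all $y\in M$. Let $\mu$ be a probability measure on $M$ with a density $p$ with respect to the $d$-dimensional volume $dy$ on $M$, with $0<p_{\min}\le p\le p_{\max}$ and $\|p\circ\Phi_y\|_{C^\alpha(B_{T_yM}(0,\tau/8))}\le L_\mu$ for all $y\in M$. Let $C_{\log}>\max(d,4)$ satisfy $e^{-C_{\log}}<p(y)<e^{C_{\log}}$ on $M$, $\log\operatorname{Vol}M<e^{C_{\log}}$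 and $\min(\tau,L_M^{-1})\ge e^{-C_{\log}}$. For $t>0$ let $c_t=e^{-t}$ and $\sigma_t=\sqrt{1-e^{-2t}}$. Let $X(0)\sim\mu$ and $Z_D\sim\mathcal N(0,\mathrm{Id}_D)$ be independent and $X(t)=c_tX(0)+\sigma_tZ_D$. Let $p(t,x)=\int e^{-\|x-c_ty\|^2/2\sigma_t^2}\mu(dy)$, let $s(t,x)=\nabla_x\log p(t,x)$ be the score, and let $p(y\mid t,x)\propto e^{-\|x-c_ty\|^2/2\sigma_t^2}p(y)$, normalised by $\int_Mp(y\mid t,x)\,dy=1$, be the posterior density of $X(0)$ given $X(t)=x$. For $t,\delta,\eta>0$ let $$r(t,\delta,\eta)=2\frac{\sigma_t}{c_t}\sqrt{20d\left(\log_+(\sigma_t/c_t)^{-1}+4C_{\log}\right)+8\log\delta^{-1}+\log\eta^{-1}}.$$ **Theorem.** There is a constant $K>0$ depending only on $\alpha$ and $\beta$ such that the following holds for all $D$, $d$, $M$, $\mu$, $C_{\log}$ as above and all $t,\delta,\eta>0$. (i) For $\mu$-almost every value of $X(0)$, with probability at least $1-\delta$ in $Z_D$, $$\int_{y\in M:\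 \|y-X(0)\|\le r(t,\delta,\eta)}p(y\mid t,X(t))\,dy\ \ge\ 1-\eta.$$ (ii) For $\mu$-almost every value of $X(0)$, with probability at least $1-\delta$ in $Z_D$, $$\|\sigma_ts(t,X(t))+Z_D\|\ \le\ K\cdot 4\sqrt{20d\left(2\log_+(\sigma_t/c_t)^{-1}+4C_{\log}\right)+8\log\delta^{-1}}.$$ (iii) For every $y\in M$, $\|\sigma_ts(t,c_ty+\sigma_tZ_D)+Z_D\|^2$ is integrable and $$\mathbb E\,\|\sigma_ts(t,c_ty+\sigma_tZ_D)+Z_D\|^2\ \le\ K\cdot 8\left(40d\log_+(\sigma_t/c_t)^{-1}+80\,d\,C_{\log}+3\right).$$ (In (i) and (ii) a bound with probability at least $1-\delta$ is vacuous for $\delta\ge1$.) -/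

import Mathlib

open MeasureTheory ProbabilityTheory Metric
open scoped ENNReal NNReal

namespace ScoreConcentration

noncomputable section

/-- The ambient Euclidean space `ℝ^D`. -/
abbrev Amb (D : ℕ) : Type := EuclideanSpace ℝ (Fin D)

/-! ### Geometry of the support -/

/-- The reach of `M`: the supremum of those `ε` for which every point at distance less than `ε`
from `M` has a unique nearest point on `M`. -/
def reach {D : ℕ} (M : Set (Amb D)) : ℝ≥0∞ :=
  ⨆ (ε : ℝ≥0) (_ : ∀ x : Amb D, infDist x M < ε → ∃! y, y ∈ M ∧ infDist x M = dist x y),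
    (ε : ℝ≥0∞)

/-- The tangent space `T_y M`, as a linear subspace of `ℝ^D` (the span of the tangent cone; for
a submanifold the tangent cone is already a linear subspace). -/
def tangentSpaceOf {D : ℕ} (M : Set (Amb D)) (y : Amb D) : Submodule ℝ (Amb D) :=
  Submodule.span ℝ (tangentConeAt ℝ M y)

/-- The orthogonal projection `π_y` of `ℝ^D` onto `T_y M`, with `y` as the origin. -/
def tangentProj {D : ℕ} (M : Set (Amb D)) (y x : Amb D) : tangentSpaceOf M y :=
  (tangentSpaceOf M y).orthogonalProjectionOnto (x - y)

/-- `Φ`, considered on the ball `B(0, τ/8)` of `T_y M`, is the inverse of the restriction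
of `π_y` to `M ∩ B(y, τ/4)`. Its values off the ball `B(0, τ/8)` play no role. -/
structure IsInverseProjection {D : ℕ} (M : Set (Amb D)) (τ : ℝ) (y : Amb D)
    (Φ : tangentSpaceOf M y → Amb D) : Prop where
  mem : ∀ z ∈ ball (0 : tangentSpaceOf M y) (τ / 8), Φ z ∈ M ∩ ball y (τ / 4)
  right_inv : ∀ z ∈ ball (0 : tangentSpaceOf M y) (τ / 8), tangentProj M y (Φ z) = z
  left_inv : ∀ x ∈ M ∩ ball y (τ / 4),
    tangentProj M y x ∈ ball (0 : tangentSpaceOf M y) (τ / 8) → Φ (tangentProj M y x) = x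

/-- `f` is of class `C^k` on the open set `Ω` and `‖f‖_{C^k(Ω)} ≤ L`, where
`‖f‖_{C^k(Ω)} = max_{i ≤ k} sup_{x ∈ Ω} ‖d^i f(x)‖_op`. -/
def CkNormLE {V W : Type*} [NormedAddCommGroup V] [NormedSpace ℝ V]
    [NormedAddCommGroup W] [NormedSpace ℝ W] (k : ℕ) (f : V → W) (Ω : Set V) (L : ℝ) : Prop :=
  ContDiffOn ℝ k f Ω ∧ ∀ i ≤ k, ∀ x ∈ Ω, ‖iteratedFDeriv ℝ i f x‖ ≤ L

/-- `M` is a compact `β`-smooth submanifold of `ℝ^D` of dimension `d ≥ 3` and reach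
`τ > τmin > 0`, all of whose inverse projections `Φ_y` on `B_{T_y M}(0, τ/8)` have
`C^β`-norm at most `LM`. In particular, near each of its points `y`, `M` is the graph
of a `C^β` map over a ball of the `d`-dimensional space `T_y M`. -/
structure IsRegularManifold {D : ℕ} (β d : ℕ) (τmin τ LM : ℝ) (M : Set (Amb D)) : Prop where
  isCompact : IsCompact M
  three_le_dim : 3 ≤ d
  finrank_tangent : ∀ y ∈ M, Module.finrank ℝ (tangentSpaceOf M y) = d
  reach_eq : reach M = ENNReal.ofReal τ
  τmin_pos : 0 < τmin
  τmin_lt : τmin < τ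
  LM_pos : 0 < LM
  chart : ∀ y ∈ M, ∃ Φ : tangentSpaceOf M y → Amb D, IsInverseProjection M τ y Φ ∧
    CkNormLE β Φ (ball (0 : tangentSpaceOf M y) (τ / 8)) LM

/-! ### The data distribution -/

/-- `μ` lives on `M` and has there the density `p` with respect to the `d`-dimensional volume
(the Hausdorff measure, normalised to agree with Lebesgue measure on `ℝ^d`),
`pmin ≤ p ≤ pmax` with `pmin > 0`, and in the charts `Φ_y` the `C^α`-norm of `p` is at
most `Lμ`. As `p` is positive on `M`, the support of `μ` is `M`. -/
structure HasRegularDensity {D : ℕ} (α d : ℕ) (τ pmin pmax Lμ : ℝ) (M : Set (Amb D))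
    (p : Amb D → ℝ) (μ : Measure (Amb D)) : Prop where
  eq_withDensity : μ = ((μHE[d] : Measure (Amb D)).restrict M).withDensity
    (fun y => ENNReal.ofReal (p y))
  pmin_pos : 0 < pmin
  pmin_le : ∀ y ∈ M, pmin ≤ p y
  le_pmax : ∀ y ∈ M, p y ≤ pmax
  smooth : ∀ y ∈ M, ∀ Φ : tangentSpaceOf M y → Amb D, IsInverseProjection M τ y Φ →
    CkNormLE α (fun z => p (Φ z)) (ball (0 : tangentSpaceOf M y) (τ / 8)) Lμ

/-- `Clog > max (d, 4)` bounds the logarithmic complexity of the measure: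
`e^{-Clog} < p < e^{Clog}` on `M`, `log Vol M < e^{Clog}` and
`min (τ, LM⁻¹) ≥ e^{-Clog}`. -/
structure IsLogComplexity {D : ℕ} (d : ℕ) (τ LM Clog : ℝ) (M : Set (Amb D))
    (p : Amb D → ℝ) : Prop where
  max_lt : max (d : ℝ) 4 < Clog
  lt_density : ∀ y ∈ M, Real.exp (-Clog) < p y
  density_lt : ∀ y ∈ M, p y < Real.exp Clog
  log_vol_lt : Real.log ((μHE[d] : Measure (Amb D)) M).toReal < Real.exp Clog
  le_min : Real.exp (-Clog) ≤ min τ LM⁻¹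

/-! ### The Ornstein–Uhlenbeck forward process -/

/-- `c_t = e^{-t}`. -/
def cc (t : ℝ) : ℝ := Real.exp (-t)

/-- `σ_t = √(1 - e^{-2t})`. -/
def sg (t : ℝ) : ℝ := Real.sqrt (1 - Real.exp (-2 * t))

/-- `X(t) = c_t x₀ + σ_t z`, the forward process at time `t` with start `x₀` and noise `z`. -/
def fwd {D : ℕ} (t : ℝ) (x₀ z : Amb D) : Amb D := cc t • x₀ + sg t • z

/-- The Gaussian weight `e^{-‖x - c_t y‖² / (2 σ_t²)}`. -/
def gaussWeight {D : ℕ} (t : ℝ) (x y : Amb D) : ℝ :=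
  Real.exp (-‖x - cc t • y‖ ^ 2 / (2 * sg t ^ 2))

/-- The (unnormalised) density `p(t, x) = ∫ e^{-‖x - c_t y‖² / (2 σ_t²)} μ(dy)` of `X(t)`. -/
def marginal {D : ℕ} (μ : Measure (Amb D)) (t : ℝ) (x : Amb D) : ℝ :=
  ∫ y, gaussWeight t x y ∂μ

/-- The score function `s(t, x) = ∇ log p(t, x)`. -/
def score {D : ℕ} (μ : Measure (Amb D)) (t : ℝ) (x : Amb D) : Amb D :=
  gradient (fun x' => Real.log (marginal μ t x')) x

/-- The posterior density `p(y | t, x)` of `X(0)` given `X(t) = x`, with respect to the volume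
`dy` of `M`: proportional to `e^{-‖x - c_t y‖² / (2 σ_t²)} p(y)`, with integral one on `M`. -/
def posteriorDensity {D : ℕ} (d : ℕ) (M : Set (Amb D)) (p : Amb D → ℝ) (t : ℝ)
    (x y : Amb D) : ℝ :=
  gaussWeight t x y * p y / ∫ y' in M, gaussWeight t x y' * p y' ∂(μHE[d] : Measure (Amb D))

/-- `log₊ ((σ_t / c_t)⁻¹)`, where `log₊ x = max (log x, 0)`. -/
def logInvRatio (t : ℝ) : ℝ := max (Real.log (sg t / cc t)⁻¹) 0

/-- The radius `r(t, δ, η)`. -/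
def radius (d : ℕ) (Clog t δ η : ℝ) : ℝ :=
  2 * (sg t / cc t) * Real.sqrt
    (20 * d * (logInvRatio t + 4 * Clog) + 8 * Real.log δ⁻¹ + Real.log η⁻¹)

end

end ScoreConcentration

/-! Put `ρ = c_t / σ_t`. Up to a factor depending only on the noise `z`, the posterior given `X(t) =
c_t x₀ + σ_t z` is `μ` weighted by `relWeight ρ x₀ z`. For each fixed `y` this likelihood ratio has
Gaussian mean one, so a first moment cannot show that far points carry little mass. Its power `1/8`
has mean of order `exp(-c ρ² ‖x₀ - y‖²)`, so fractional moments can.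

Take a net of `M` at scale `ε` with `ρ ε ≤ 1/8`. Within one ball of the net the log-likelihood
varies little, apart from Gaussian factors of slope at most `1/8`. The normalising constant is
bounded below by Jensen on the `ε`-ball at `x₀`. The resulting lower bound is `exp` of a linear
function of `z`, so it merges with the numerator and the `1/8`-moment of the quotient is still
computable (`lintegral_rpow_relWeight_ball_le`). Subadditivity of `x ↦ x^(1/8)` sums over the net,
and Markov's inequality gives `stdGaussian_relWeight_tail_le`. Nothing about suprema of Gaussian
processes is needed.

The geometry enters through one number, the least mass `m` of an `ε/2`-ball centred on `M`. It
bounds the normaliser, and a packing argument bounds the net by `1/m`. Charts and the complexity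
constant give `m ≥ exp(-d (L + 4 Clog))` with `L = log₊ ρ` (`le_measure_ball`). This proves (i).

For (ii), Tweedie's formula (`sg_smul_score_add`) turns the score error into `ρ` times the shift of
the posterior mean from `x₀`. That shift is at most `r + η` because `diam M ≤ 1`, and `η = exp(-L)`
makes `ρ η ≤ 1`. Integrating the tail in (ii) gives (iii). -/

open MeasureTheory ProbabilityTheory Metric
open scoped ENNReal NNReal

namespace ScoreConcentration

/-! ### Fractional Gaussian moments of likelihood ratios -/

section Gaussian

open scoped RealInnerProductSpace

variable {E : Type*} [NormedAddCommGroup E] [InnerProductSpace ℝ E]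

/-- The density of the law of the observation started at `y`, relative to the one started at
`x₀`, at signal-to-noise ratio `ρ`. -/
noncomputable def relWeight (ρ : ℝ) (x₀ z y : E) : ℝ :=
  Real.exp (-ρ * ⟪x₀ - y, z⟫ - ρ ^ 2 * ‖x₀ - y‖ ^ 2 / 2)

lemma relWeight_pos (ρ : ℝ) (x₀ z y : E) : 0 < relWeight ρ x₀ z y := Real.exp_pos _

lemma continuous_relWeight (ρ : ℝ) (x₀ : E) :
    Continuous (Function.uncurry (relWeight ρ x₀)) := by
  unfold relWeight Function.uncurry
  fun_prop

lemma continuous_relWeight_right (ρ : ℝ) (x₀ z : E) : Continuous (relWeight ρ x₀ z) :=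
  (continuous_relWeight ρ x₀).comp (by fun_prop : Continuous fun y : E => (z, y))

variable [FiniteDimensional ℝ E] [MeasurableSpace E] [BorelSpace E]

/-- The Laplace transform of the standard Gaussian. -/
lemma lintegral_exp_inner_stdGaussian (v : E) :
    ∫⁻ z, ENNReal.ofReal (Real.exp ⟪v, z⟫) ∂(stdGaussian E) =
      ENNReal.ofReal (Real.exp (‖v‖ ^ 2 / 2)) := by
  have hmap : (stdGaussian E).map (fun z => ⟪v, z⟫) = gaussianReal 0 (‖v‖ ^ 2).toNNReal := by
    have h := IsGaussian.map_eq_gaussianReal (μ := stdGaussian E) (innerSL ℝ v)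
    rw [integral_strongDual_stdGaussian, variance_dual_stdGaussian, innerSL_apply_norm] at h
    exact h
  have hmgf := mgf_gaussianReal hmap 1
  have hint : Integrable (fun z => Real.exp ⟪v, z⟫) (stdGaussian E) := by
    have h := integrable_exp_mul_gaussianReal (μ := 0) (v := (‖v‖ ^ 2).toNNReal) 1
    rw [← hmap] at h
    have := (integrable_map_measure (by fun_prop) (by fun_prop)).1 h
    simpa [Function.comp_def] using this
  rw [← ofReal_integral_eq_lintegral_ofReal hint (ae_of_all _ fun _ => (Real.exp_pos _).le)]
  simp only [mgf, one_mul, zero_add, one_pow, mul_one] at hmgf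
  rw [hmgf, Real.coe_toNNReal _ (by positivity)]

/-- A fractional moment of a product of a Gaussian exponential and a mixture of Gaussian
exponentials with small slopes. -/
lemma lintegral_rpow_exp_inner_mul_le (v : E) (ν : Measure E) [SFinite ν] {u : E → E}
    (hu : Measurable u) {b : ℝ} (hb : ∀ᵐ y ∂ν, ‖u y‖ ≤ b) :
    ∫⁻ z, (ENNReal.ofReal (Real.exp ⟪v, z⟫) *
        ∫⁻ y, ENNReal.ofReal (Real.exp ⟪u y, z⟫) ∂ν) ^ (1 / 8 : ℝ) ∂(stdGaussian E) ≤
      ENNReal.ofReal (Real.exp (‖v‖ ^ 2 / 112)) *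
        (ENNReal.ofReal (Real.exp (b ^ 2 / 2)) * ν Set.univ) ^ (1 / 8 : ℝ) := by
  have hmeas : Measurable (Function.uncurry fun (z : E) (y : E) =>
      ENNReal.ofReal (Real.exp ⟪u y, z⟫)) := by
    refine ENNReal.measurable_ofReal.comp (Real.measurable_exp.comp ?_)
    exact (hu.comp measurable_snd).inner measurable_fst
  -- Arranged for Hölder with weights `7/8` and `1/8`: the mixture then enters to the first power,
  -- where Fubini applies, and the exponential has slope `v / 7`.
  have hrw : ∀ z : E, (ENNReal.ofReal (Real.exp ⟪v, z⟫) *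
      ∫⁻ y, ENNReal.ofReal (Real.exp ⟪u y, z⟫) ∂ν) ^ (1 / 8 : ℝ) =
      ENNReal.ofReal (Real.exp ⟪(1 / 7 : ℝ) • v, z⟫) ^ (7 / 8 : ℝ) *
      (∫⁻ y, ENNReal.ofReal (Real.exp ⟪u y, z⟫) ∂ν) ^ (1 / 8 : ℝ) := by
    intro z
    rw [ENNReal.mul_rpow_of_nonneg _ _ (by norm_num),
      ENNReal.ofReal_rpow_of_pos (Real.exp_pos _), ENNReal.ofReal_rpow_of_pos (Real.exp_pos _),
      ← Real.exp_mul, ← Real.exp_mul, real_inner_smul_left]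
    congr 3
    ring
  simp_rw [hrw]
  refine (ENNReal.lintegral_mul_norm_pow_le (by fun_prop)
    hmeas.lintegral_prod_right'.aemeasurable (by norm_num) (by norm_num) (by norm_num)).trans ?_
  rw [lintegral_exp_inner_stdGaussian]
  gcongr
  -- `(7/8) · (1/7)² / 2 = 1/112`.
  · rw [ENNReal.ofReal_rpow_of_pos (Real.exp_pos _), ← Real.exp_mul, norm_smul]
    apply le_of_eq
    congr 2
    norm_num
    ring
  · simp only [Function.uncurry_apply_pair]
    rw [lintegral_lintegral_swap hmeas.aemeasurable]
    simp_rw [lintegral_exp_inner_stdGaussian]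
    calc ∫⁻ y, ENNReal.ofReal (Real.exp (‖u y‖ ^ 2 / 2)) ∂ν
        ≤ ∫⁻ _, ENNReal.ofReal (Real.exp (b ^ 2 / 2)) ∂ν := by
          refine lintegral_mono_ae (hb.mono fun y hy => ?_)
          gcongr
      _ = _ := by rw [lintegral_const]

/-- Jensen's lower bound for the normalising constant of the posterior. -/
lemma le_lintegral_relWeight (μ : Measure E) [IsProbabilityMeasure μ] (x₀ : E) {ρ ε m : ℝ}
    (hρ : 0 < ρ) (hρε : ρ * ε ≤ 1 / 8) (hm : 0 < m)
    (hμ : ENNReal.ofReal m ≤ μ (closedBall x₀ ε)) :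
    ∃ a : E, ‖a‖ ≤ ε ∧ ∀ z, ENNReal.ofReal (m * Real.exp (-ρ * ⟪a, z⟫ - 1 / 128)) ≤
      ∫⁻ y, ENNReal.ofReal (relWeight ρ x₀ z y) ∂μ := by
  set ν := μ.restrict (closedBall x₀ ε) with hν
  have hae : ∀ᵐ y ∂ν, y ∈ closedBall x₀ ε := ae_restrict_mem isClosed_closedBall.measurableSet
  have hnorm : ∀ᵐ y ∂ν, ‖x₀ - y‖ ≤ ε := hae.mono fun y hy => by
    rw [← dist_eq_norm, dist_comm]; exact hy
  have hν0 : ν ≠ 0 := by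
    intro h
    have : ν Set.univ = 0 := by simp [h]
    rw [hν, Measure.restrict_apply_univ] at this
    rw [this] at hμ
    simp [hm.not_ge] at hμ
  have : NeZero ν := ⟨hν0⟩
  have hintv : Integrable (fun y => x₀ - y) ν :=
    Integrable.of_bound (by fun_prop) ε hnorm
  -- The mean displacement over the ball. It does not depend on `z`, so the lower bound is a single
  -- Gaussian exponential.
  refine ⟨⨍ y, (x₀ - y) ∂ν, ?_, fun z => ?_⟩
  · exact (convex_closedBall (0 : E) ε).average_mem isClosed_closedBall
      (hnorm.mono fun y hy => by simpa using hy) hintv |> fun h => by simpa using h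
  have hint : ∀ᵐ y ∂ν, ‖Real.exp (-ρ * ⟪x₀ - y, z⟫)‖ ≤ Real.exp (ρ * (ε * ‖z‖)) := by
    refine hnorm.mono fun y hy => ?_
    rw [Real.norm_of_nonneg (Real.exp_pos _).le]
    have h1 := abs_real_inner_le_norm (x₀ - y) z
    have h2 : ‖x₀ - y‖ * ‖z‖ ≤ ε * ‖z‖ := by gcongr
    have h3 := neg_abs_le ⟪x₀ - y, z⟫
    rw [Real.exp_le_exp, neg_mul, ← mul_neg]
    gcongr
    linarith
  have hintexp : Integrable (fun y => Real.exp (-ρ * ⟪x₀ - y, z⟫)) ν :=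
    Integrable.of_bound (by fun_prop) _ hint
  have hintlin : Integrable (fun y => -ρ * ⟪x₀ - y, z⟫) ν :=
    (hintv.inner_const z).const_mul _
  have hjensen := convexOn_exp.map_average_le (μ := ν) (f := fun y => -ρ * ⟪x₀ - y, z⟫)
    Real.continuous_exp.continuousOn isClosed_univ (by simp) hintlin hintexp
  have havg : (⨍ y, -ρ * ⟪x₀ - y, z⟫ ∂ν) = -ρ * ⟪⨍ y, (x₀ - y) ∂ν, z⟫ := by
    simp only [average]
    rw [integral_const_mul]
    congr 1
    have := (hintv.to_average)
    rw [real_inner_comm, ← integral_inner this z]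
    simp_rw [real_inner_comm]
  rw [havg] at hjensen
  simp only [average_eq, smul_eq_mul] at hjensen
  have hpos : 0 < ν.real Set.univ := by
    exact ENNReal.toReal_pos (by simpa using hν0) (measure_ne_top _ _)
  rw [le_inv_mul_iff₀ hpos] at hjensen
  have hmν : m ≤ ν.real Set.univ := by
    rw [Measure.real, hν, Measure.restrict_apply_univ]
    exact (ENNReal.ofReal_le_iff_le_toReal (measure_ne_top _ _)).1 hμ
  calc ENNReal.ofReal (m * Real.exp (-ρ * ⟪⨍ y, (x₀ - y) ∂ν, z⟫ - 1 / 128))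
      ≤ ENNReal.ofReal ((∫ y, Real.exp (-ρ * ⟪x₀ - y, z⟫) ∂ν) * Real.exp (-(1 / 128))) := by
        apply ENNReal.ofReal_le_ofReal
        rw [sub_eq_add_neg, Real.exp_add, ← mul_assoc]
        gcongr
        refine le_trans ?_ hjensen
        simp only [average_eq]
        gcongr
    _ = ∫⁻ y, ENNReal.ofReal (Real.exp (-ρ * ⟪x₀ - y, z⟫) * Real.exp (-(1 / 128))) ∂ν := by
        rw [← integral_mul_const, ofReal_integral_eq_lintegral_ofReal (hintexp.mul_const _)]
        exact ae_of_all _ fun _ => by positivity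
    _ ≤ ∫⁻ y, ENNReal.ofReal (relWeight ρ x₀ z y) ∂ν := by
        refine lintegral_mono_ae (hnorm.mono fun y hy => ?_)
        rw [← Real.exp_add, relWeight]
        gcongr
        -- The quadratic term costs at most `(1/8)² / 2 = 1/128`.
        have h1 : ρ * ‖x₀ - y‖ ≤ 1 / 8 := by nlinarith
        have h0 : 0 ≤ ρ * ‖x₀ - y‖ := by positivity
        nlinarith
    _ ≤ _ := lintegral_mono' Measure.restrict_le_self le_rfl

/-- The contribution of a small ball far from `x₀` to the posterior. -/
lemma lintegral_rpow_relWeight_ball_le (μ : Measure E) [IsProbabilityMeasure μ] (x₀ a c : E)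
    {ρ ε r : ℝ} (hρ : 0 < ρ) (hρε : ρ * ε ≤ 1 / 8) (hρr : 60 ≤ ρ * r) (ha : ‖a‖ ≤ ε) :
    ∫⁻ z, (ENNReal.ofReal (Real.exp (ρ * ⟪a, z⟫)) *
        ∫⁻ y in closedBall c ε ∩ {y | r < ‖y - x₀‖}, ENNReal.ofReal (relWeight ρ x₀ z y) ∂μ)
          ^ (1 / 8 : ℝ) ∂(stdGaussian E) ≤
      ENNReal.ofReal (Real.exp (-(ρ * r) ^ 2 / 24 - 1 / 1024)) := by
  set A := closedBall c ε ∩ {y | r < ‖y - x₀‖} with hA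
  have hAm : MeasurableSet A := isClosed_closedBall.measurableSet.inter
    (isOpen_lt (by fun_prop) (by fun_prop)).measurableSet
  rcases A.eq_empty_or_nonempty with h | ⟨y₀, hy₀, hry₀⟩
  · simp [h]
  set R := ‖x₀ - c‖ with hR
  have hε : 0 ≤ ε := (norm_nonneg a).trans ha
  have hRr : r - ε ≤ R := by
    have h1 : ‖y₀ - x₀‖ ≤ ‖y₀ - c‖ + ‖c - x₀‖ := norm_sub_le_norm_sub_add_norm_sub _ _ _
    have h2 : ‖y₀ - c‖ ≤ ε := by simpa [dist_eq_norm] using hy₀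
    have h3 : r < ‖y₀ - x₀‖ := hry₀
    rw [norm_sub_rev c x₀] at h1
    linarith
  have hq : ρ * r - 1 / 8 ≤ ρ * R := by nlinarith
  -- The slope common to the whole ball around `c`, including the contribution `a` of the
  -- normaliser; what remains for `y` is `ρ • (y - c)`, of norm at most `1/8`.
  set v : E := -(ρ • (x₀ - c - a)) with hv
  have hvn : ‖v‖ ≤ ρ * R + 1 / 8 := by
    rw [hv, norm_neg, norm_smul, Real.norm_of_nonneg hρ.le]
    have : ‖x₀ - c - a‖ ≤ R + ε := (norm_sub_le _ _).trans (by gcongr)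
    nlinarith
  have hpt : ∀ z, ENNReal.ofReal (Real.exp (ρ * ⟪a, z⟫)) *
        ∫⁻ y in A, ENNReal.ofReal (relWeight ρ x₀ z y) ∂μ ≤
      ENNReal.ofReal (Real.exp (-(ρ * R - 1 / 8) ^ 2 / 2)) * (ENNReal.ofReal (Real.exp ⟪v, z⟫) *
        ∫⁻ y in A, ENNReal.ofReal (Real.exp ⟪ρ • (y - c), z⟫) ∂μ) := by
    intro z
    rw [← lintegral_const_mul' _ _ ENNReal.ofReal_ne_top,
      ← lintegral_const_mul' _ _ ENNReal.ofReal_ne_top,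
      ← lintegral_const_mul' _ _ ENNReal.ofReal_ne_top]
    refine setLIntegral_mono' hAm fun y hy => ?_
    rw [← ENNReal.ofReal_mul (Real.exp_pos _).le, ← ENNReal.ofReal_mul (Real.exp_pos _).le,
      ← ENNReal.ofReal_mul (Real.exp_pos _).le, relWeight, ← Real.exp_add, ← Real.exp_add,
      ← Real.exp_add]
    refine ENNReal.ofReal_le_ofReal (Real.exp_le_exp.2 ?_)
    have hin : ⟪v, z⟫ + ⟪ρ • (y - c), z⟫ = ρ * ⟪a, z⟫ - ρ * ⟪x₀ - y, z⟫ := by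
      simp only [hv, inner_neg_left, real_inner_smul_left, inner_sub_left]
      ring
    have h2 : ‖y - c‖ ≤ ε := by simpa [dist_eq_norm] using hy.1
    have h1 : R ≤ ‖x₀ - y‖ + ‖y - c‖ := norm_sub_le_norm_sub_add_norm_sub _ _ _
    have h3 : ρ * R - 1 / 8 ≤ ρ * ‖x₀ - y‖ := by nlinarith
    have h4 : (ρ * R - 1 / 8) ^ 2 ≤ (ρ * ‖x₀ - y‖) ^ 2 := by
      apply pow_le_pow_left₀ _ h3
      linarith
    rw [hin]
    nlinarith
  have hb : ∀ᵐ y ∂(μ.restrict A), ‖ρ • (y - c)‖ ≤ 1 / 8 :=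
    (ae_restrict_mem hAm).mono fun y hy => by
      have h2 : ‖y - c‖ ≤ ε := by simpa [dist_eq_norm] using hy.1
      rw [norm_smul, Real.norm_of_nonneg hρ.le]
      nlinarith
  calc _ ≤ ∫⁻ z, (ENNReal.ofReal (Real.exp (-(ρ * R - 1 / 8) ^ 2 / 2)) *
          (ENNReal.ofReal (Real.exp ⟪v, z⟫) *
          ∫⁻ y in A, ENNReal.ofReal (Real.exp ⟪ρ • (y - c), z⟫) ∂μ)) ^ (1 / 8 : ℝ)
          ∂(stdGaussian E) := lintegral_mono fun z => by
            exact ENNReal.rpow_le_rpow (hpt z) (by norm_num)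
    _ ≤ ENNReal.ofReal (Real.exp (-(ρ * R - 1 / 8) ^ 2 / 2)) ^ (1 / 8 : ℝ) *
        (ENNReal.ofReal (Real.exp ((ρ * R + 1 / 8) ^ 2 / 112)) *
          (ENNReal.ofReal (Real.exp ((1 / 8) ^ 2 / 2)) * 1) ^ (1 / 8 : ℝ)) := by
        simp_rw [ENNReal.mul_rpow_of_nonneg (ENNReal.ofReal (Real.exp (-(ρ * R - 1 / 8) ^ 2 / 2))) _
          (by norm_num : (0 : ℝ) ≤ 1 / 8)]
        rw [lintegral_const_mul' _ _ (by finiteness)]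
        gcongr
        refine (lintegral_rpow_exp_inner_mul_le v _ (by fun_prop) hb).trans ?_
        gcongr
        simpa using prob_le_one (μ := μ) (s := A)
    _ ≤ _ := by
        rw [mul_one, ENNReal.ofReal_rpow_of_pos (Real.exp_pos _),
          ENNReal.ofReal_rpow_of_pos (Real.exp_pos _), ← ENNReal.ofReal_mul (by positivity),
          ← ENNReal.ofReal_mul (by positivity), ← Real.exp_mul, ← Real.exp_mul, ← Real.exp_add,
          ← Real.exp_add]
        -- With `q = ρ R`, the exponent is `-(q - 1/8)²/16 + (q + 1/8)²/112 + 1/1024`. Its leading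
        -- coefficient `-3/56` is below `-1/24`, and `60 ≤ ρ r` leaves room for the lower-order
        -- terms.
        gcongr
        nlinarith

/-- The posterior puts little mass outside the ball of radius `r` around the true starting
point, with high probability in the noise. -/
lemma stdGaussian_relWeight_tail_le (μ : Measure E) [IsProbabilityMeasure μ] (x₀ : E)
    {ρ ε r η m : ℝ} (T : Finset E) (hρ : 0 < ρ) (hρε : ρ * ε ≤ 1 / 8)
    (hρr : 60 ≤ ρ * r) (hη : 0 < η) (hm : 0 < m)
    (hcov : ∀ᵐ y ∂μ, ∃ c ∈ T, dist y c ≤ ε) (hμ : ENNReal.ofReal m ≤ μ (closedBall x₀ ε)) :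
    stdGaussian E {z | ENNReal.ofReal η * ∫⁻ y, ENNReal.ofReal (relWeight ρ x₀ z y) ∂μ <
        ∫⁻ y in {y | r < ‖y - x₀‖}, ENNReal.ofReal (relWeight ρ x₀ z y) ∂μ} ≤
      ENNReal.ofReal (T.card * Real.exp (-(ρ * r) ^ 2 / 24) / (η * m) ^ (1 / 8 : ℝ)) := by
  obtain ⟨a, ha, hden⟩ := le_lintegral_relWeight μ x₀ hρ hρε hm hμ
  set S := {y | r < ‖y - x₀‖} with hS
  have hSm : MeasurableSet S := (isOpen_lt (by fun_prop) (by fun_prop)).measurableSet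
  set N : E → E → ℝ≥0∞ := fun c z =>
    ∫⁻ y in closedBall c ε ∩ S, ENNReal.ofReal (relWeight ρ x₀ z y) ∂μ with hN
  have hNm : ∀ c, Measurable (N c) := fun c =>
    Measurable.lintegral_prod_right' (f := fun q : E × E => ENNReal.ofReal (relWeight ρ x₀ q.1 q.2))
      (ENNReal.measurable_ofReal.comp (continuous_relWeight ρ x₀).measurable)
  set G : E → E → ℝ≥0∞ := fun c z =>
    (ENNReal.ofReal (Real.exp (ρ * ⟪a, z⟫)) * N c z) ^ (1 / 8 : ℝ) with hG
  have hGm : ∀ c, Measurable (G c) := fun c => by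
    have := hNm c
    simp only [hG]
    fun_prop
  have hsum : ∀ z, ∫⁻ y in S, ENNReal.ofReal (relWeight ρ x₀ z y) ∂μ ≤ ∑ c ∈ T, N c z := by
    intro z
    have hf : Measurable fun y => ENNReal.ofReal (relWeight ρ x₀ z y) :=
      ENNReal.measurable_ofReal.comp (continuous_relWeight_right ρ x₀ z).measurable
    have hAm : ∀ c, MeasurableSet (closedBall c ε ∩ S) := fun c =>
      isClosed_closedBall.measurableSet.inter hSm
    simp only [hN]
    simp_rw [← lintegral_indicator (hAm _)]
    rw [← lintegral_indicator hSm, ← lintegral_finsetSum _ fun c _ => hf.indicator (hAm c)]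
    refine lintegral_mono_ae (hcov.mono fun y ⟨c, hc, hyc⟩ => ?_)
    by_cases hy : y ∈ S
    · refine le_trans ?_ (Finset.single_le_sum (fun _ _ => zero_le) hc)
      rw [Set.indicator_of_mem hy,
        Set.indicator_of_mem (show y ∈ closedBall c ε ∩ S from ⟨hyc, hy⟩)]
    · simp [Set.indicator_of_notMem hy]
  -- The `1/8`-th power of `η m exp(-1/128)`. The factor `exp(-1/1024)` cancels against the one in
  -- the single-ball estimate.
  set θ : ℝ := (η * m) ^ (1 / 8 : ℝ) * Real.exp (-1 / 1024) with hθ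
  have hθpos : 0 < θ := by positivity
  have hsub : {z | ENNReal.ofReal η * ∫⁻ y, ENNReal.ofReal (relWeight ρ x₀ z y) ∂μ <
        ∫⁻ y in S, ENNReal.ofReal (relWeight ρ x₀ z y) ∂μ} ⊆
      {z | ENNReal.ofReal θ ≤ ∑ c ∈ T, G c z} := by
    intro z hz
    have h1 : ENNReal.ofReal (η * m * Real.exp (-1 / 128)) ≤
        ∑ c ∈ T, ENNReal.ofReal (Real.exp (ρ * ⟪a, z⟫)) * N c z := by
      calc ENNReal.ofReal (η * m * Real.exp (-1 / 128))
          = ENNReal.ofReal (Real.exp (ρ * ⟪a, z⟫)) * (ENNReal.ofReal η *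
            ENNReal.ofReal (m * Real.exp (-ρ * ⟪a, z⟫ - 1 / 128))) := by
            rw [← ENNReal.ofReal_mul (by positivity), ← ENNReal.ofReal_mul (by positivity)]
            congr 1
            rw [show -1 / 128 = ρ * ⟪a, z⟫ + (-ρ * ⟪a, z⟫ - 1 / 128) by ring, Real.exp_add]
            ring
        _ ≤ ENNReal.ofReal (Real.exp (ρ * ⟪a, z⟫)) * ∑ c ∈ T, N c z := by
            gcongr
            refine le_trans ?_ (hz.le.trans (hsum z))
            gcongr
            exact hden z
        _ = _ := Finset.mul_sum _ _ _
    calc ENNReal.ofReal θ = ENNReal.ofReal (η * m * Real.exp (-1 / 128)) ^ (1 / 8 : ℝ) := by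
          rw [ENNReal.ofReal_rpow_of_pos (by positivity),
            Real.mul_rpow (by positivity) (by positivity), ← Real.exp_mul, hθ]
          norm_num
      _ ≤ (∑ c ∈ T, ENNReal.ofReal (Real.exp (ρ * ⟪a, z⟫)) * N c z) ^ (1 / 8 : ℝ) := by gcongr
      _ ≤ ∑ c ∈ T, G c z :=
          Finset.le_sum_of_subadditive (fun x : ℝ≥0∞ => x ^ (1 / 8 : ℝ)) (by simp)
            (fun x y => ENNReal.rpow_add_le_add_rpow x y (by norm_num) (by norm_num)) _ _
  refine (measure_mono hsub).trans ?_
  refine (meas_ge_le_lintegral_div (Finset.measurable_sum _ fun c _ => hGm c).aemeasurable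
    (by simpa using hθpos) ENNReal.ofReal_ne_top).trans ?_
  rw [lintegral_finsetSum _ fun c _ => hGm c]
  calc (∑ c ∈ T, ∫⁻ z, G c z ∂(stdGaussian E)) / ENNReal.ofReal θ
      ≤ (∑ c ∈ T, ENNReal.ofReal (Real.exp (-(ρ * r) ^ 2 / 24 - 1 / 1024))) /
        ENNReal.ofReal θ := by
        gcongr with c _
        exact lintegral_rpow_relWeight_ball_le μ x₀ a c hρ hρε hρr ha
    _ = _ := by
        rw [Finset.sum_const, nsmul_eq_mul, ← ENNReal.ofReal_natCast,
          ← ENNReal.ofReal_mul (by positivity), ← ENNReal.ofReal_div_of_pos hθpos]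
        congr 1
        rw [hθ, sub_eq_add_neg, Real.exp_add]
        have : Real.exp (-(1 / 1024)) = Real.exp (-1 / 1024) := by norm_num
        rw [this]
        field_simp

end Gaussian

/-! ### Mass of small balls and covering numbers of the support -/

section Volume

/-- A ball of a `d`-dimensional Euclidean space contains a cube of side `2 s / √d`. -/
lemma le_volume_ball_zero {V : Type*} [NormedAddCommGroup V] [InnerProductSpace ℝ V]
    [FiniteDimensional ℝ V] [MeasurableSpace V] [BorelSpace V] {d : ℕ}
    (hd : Module.finrank ℝ V = d) (hd0 : 0 < d) {s : ℝ} (hs : 0 < s) :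
    ENNReal.ofReal ((2 * s / Real.sqrt d) ^ d) ≤ volume (ball (0 : V) s) := by
  subst hd
  set d := Module.finrank ℝ V
  have hsd : 0 < Real.sqrt d := Real.sqrt_pos.2 (by exact_mod_cast hd0)
  have h1 : volume (ball (0 : V) s) = volume (ball (0 : EuclideanSpace ℝ (Fin d)) s) := by
    rw [← (stdOrthonormalBasis ℝ V).measurePreserving_repr.measure_preimage
      isOpen_ball.measurableSet.nullMeasurableSet]
    congr 1
    ext x
    simp
  have h2 : volume (ball (0 : Fin d → ℝ) (s / Real.sqrt d)) ≤
      volume (ball (0 : EuclideanSpace ℝ (Fin d)) s) := by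
    rw [← (PiLp.volume_preserving_ofLp (Fin d)).measure_preimage
      isOpen_ball.measurableSet.nullMeasurableSet]
    refine measure_mono fun x hx => ?_
    simp only [Set.mem_preimage, mem_ball, dist_zero_right] at hx ⊢
    rw [lt_div_iff₀ hsd] at hx
    refine lt_of_le_of_lt ?_ hx
    rw [EuclideanSpace.norm_eq, ← Real.sqrt_sq (norm_nonneg x.ofLp),
      ← Real.sqrt_mul (by positivity)]
    apply Real.sqrt_le_sqrt
    calc ∑ i, ‖x i‖ ^ 2 ≤ ∑ _i : Fin d, ‖x.ofLp‖ ^ 2 := by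
          gcongr with i _
          exact norm_le_pi_norm x.ofLp i
      _ = _ := by simp [mul_comm]
  rw [h1]
  refine le_trans ?_ h2
  rw [Real.volume_pi_ball _ (by positivity), Fintype.card_fin, mul_div_assoc]

variable {D : ℕ} {M : Set (Amb D)} {τ LM : ℝ} {d : ℕ}

lemma tangentProj_self (y : Amb D) : tangentProj M y y = 0 := by
  simp [tangentProj]

lemma lipschitzWith_tangentProj (y : Amb D) : LipschitzWith 1 (tangentProj M y) := by
  refine LipschitzWith.of_dist_le_mul fun a b => ?_
  rw [NNReal.coe_one, one_mul, dist_eq_norm, tangentProj, tangentProj, ← map_sub,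
    sub_sub_sub_cancel_right, dist_eq_norm]
  exact Submodule.norm_orthogonalProjectionOnto_apply_le _ _

lemma euclideanHausdorffMeasure_image_le_of_lipschitzWith_one {X Y : Type*} [EMetricSpace X]
    [MeasurableSpace X] [BorelSpace X] [EMetricSpace Y] [MeasurableSpace Y] [BorelSpace Y]
    {f : X → Y} (hf : LipschitzWith 1 f) (d : ℕ) (s : Set X) :
    (μHE[d] : Measure Y) (f '' s) ≤ (μHE[d] : Measure X) s := by
  simp only [Measure.euclideanHausdorffMeasure_def, Measure.smul_apply]
  have := hf.hausdorffMeasure_image_le (Nat.cast_nonneg (α := ℝ) d) s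
  simp only [ENNReal.coe_one, ENNReal.one_rpow, one_mul] at this
  gcongr

/-- A lower bound for the volume of the part of `M` in a small ball. -/
lemma le_euclideanHausdorffMeasure_inter_ball {y : Amb D} (hyM : y ∈ M)
    (hd : Module.finrank ℝ (tangentSpaceOf M y) = d) (hd0 : 0 < d) (hτ : 0 < τ) (hLM : 0 < LM)
    {β : ℕ} (hβ : 1 ≤ β) {Φ : tangentSpaceOf M y → Amb D} (hΦ : IsInverseProjection M τ y Φ)
    (hΦC : CkNormLE β Φ (ball (0 : tangentSpaceOf M y) (τ / 8)) LM) {ε : ℝ} (hε : 0 < ε) :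
    ENNReal.ofReal ((2 * min (τ / 8) (ε / LM) / Real.sqrt d) ^ d) ≤
      (μHE[d] : Measure (Amb D)) (M ∩ ball y ε) := by
  set s := min (τ / 8) (ε / LM) with hs
  have hs0 : 0 < s := lt_min (by positivity) (by positivity)
  refine (le_volume_ball_zero hd hd0 hs0).trans ?_
  rw [← InnerProductSpace.euclideanHausdorffMeasure_eq_volume, hd]
  -- The tangent projection is 1-Lipschitz, so it cannot increase volume; it remains to see that the
  -- projection of `M ∩ ball y ε` contains the tangent ball of radius `s`.
  refine le_trans (measure_mono ?_)
    (euclideanHausdorffMeasure_image_le_of_lipschitzWith_one (lipschitzWith_tangentProj y) d _)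
  have hτ8 : (0 : tangentSpaceOf M y) ∈ ball (0 : tangentSpaceOf M y) (τ / 8) :=
    mem_ball_self (by positivity)
  have hΦ0 : Φ 0 = y := by
    have := hΦ.left_inv y ⟨hyM, mem_ball_self (by positivity)⟩ (by rwa [tangentProj_self])
    rwa [tangentProj_self] at this
  intro z hz
  have hz8 : z ∈ ball (0 : tangentSpaceOf M y) (τ / 8) := ball_subset_ball (min_le_left _ _) hz
  refine ⟨Φ z, ⟨(hΦ.mem z hz8).1, ?_⟩, hΦ.right_inv z hz8⟩
  have hbound : ‖Φ z - Φ 0‖ ≤ LM * ‖z - 0‖ := by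
    refine (convex_ball (0 : tangentSpaceOf M y) (τ / 8)).norm_image_sub_le_of_norm_fderiv_le
      (𝕜 := ℝ) (fun x hx => ?_) (fun x hx => ?_) hτ8 hz8
    · exact (hΦC.1.contDiffAt (isOpen_ball.mem_nhds hx)).differentiableAt
        (by exact_mod_cast (by omega : β ≠ 0))
    · rw [← norm_iteratedFDeriv_one]
      exact hΦC.2 1 hβ x hx
  rw [hΦ0, sub_zero] at hbound
  rw [mem_ball, dist_eq_norm]
  have hz' : ‖z‖ < ε / LM := lt_of_lt_of_le (by simpa only [mem_ball, dist_zero_right] using hz) (min_le_right _ _)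
  calc ‖Φ z - y‖ ≤ LM * ‖z‖ := hbound
    _ < LM * (ε / LM) := by gcongr
    _ = ε := by field_simp

variable {α β : ℕ} {pmin pmax Lμ Clog τmin : ℝ} {p : Amb D → ℝ} {μ : Measure (Amb D)}

lemma IsRegularManifold.τ_pos (hM : IsRegularManifold β d τmin τ LM M) : 0 < τ :=
  hM.τmin_pos.trans hM.τmin_lt

/-- Near `y`, on `M`, `p` is the chart expression `p ∘ Φ` composed with the tangent projection.
Continuity on `M` provides the measurability of `p` needed for integrals against `μ`. -/
lemma HasRegularDensity.continuousOn (hM : IsRegularManifold β d τmin τ LM M)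
    (hp : HasRegularDensity α d τ pmin pmax Lμ M p μ) : ContinuousOn p M := by
  intro y hy
  obtain ⟨Φ, hΦ, -⟩ := hM.chart y hy
  have hτ := hM.τ_pos
  have hcont := (hp.smooth y hy Φ hΦ).1.continuousOn
  have h0 : ContinuousAt (fun z => p (Φ z)) (tangentProj M y y) := by
    rw [tangentProj_self]
    exact hcont.continuousAt (ball_mem_nhds _ (by positivity))
  have hcomp : ContinuousAt (fun x => p (Φ (tangentProj M y x))) y :=
    ContinuousAt.comp (f := tangentProj M y) h0 (lipschitzWith_tangentProj y).continuous.continuousAt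
  refine hcomp.continuousWithinAt.congr_of_eventuallyEq_of_mem ?_ hy
  filter_upwards [self_mem_nhdsWithin,
    mem_nhdsWithin_of_mem_nhds (ball_mem_nhds y (by positivity : 0 < τ / 8))] with x hxM hx
  rw [hΦ.left_inv x ⟨hxM, ball_subset_ball (by linarith) hx⟩]
  have := (lipschitzWith_tangentProj (M := M) y).dist_le_mul x y
  rw [tangentProj_self, NNReal.coe_one, one_mul] at this
  exact mem_ball.2 (this.trans_lt hx)

lemma HasRegularDensity.aemeasurable (hM : IsRegularManifold β d τmin τ LM M)
    (hp : HasRegularDensity α d τ pmin pmax Lμ M p μ) :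
    AEMeasurable p ((μHE[d] : Measure (Amb D)).restrict M) :=
  (hp.continuousOn hM).aemeasurable hM.isCompact.isClosed.measurableSet

lemma HasRegularDensity.ae_mem (hM : IsRegularManifold β d τmin τ LM M)
    (hp : HasRegularDensity α d τ pmin pmax Lμ M p μ) : ∀ᵐ y ∂μ, y ∈ M := by
  rw [hp.eq_withDensity]
  exact (withDensity_absolutelyContinuous _ _).ae_le
    (ae_restrict_mem hM.isCompact.isClosed.measurableSet)

/-- A lower bound for the mass of small balls around points of `M`. -/
lemma le_measure_ball (hβ : 1 ≤ β) (hM : IsRegularManifold β d τmin τ LM M)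
    (hp : HasRegularDensity α d τ pmin pmax Lμ M p μ)
    (hC : IsLogComplexity d τ LM Clog M p) {L : ℝ} (hL : 0 ≤ L) {y : Amb D} (hy : y ∈ M) :
    ENNReal.ofReal (Real.exp (-(d * (L + 4 * Clog)))) ≤ μ (ball y (Real.exp (-L) / 16)) := by
  have hτ := hM.τ_pos
  have hLM := hM.LM_pos
  have hd3 := hM.three_le_dim
  have hd3' : (3 : ℝ) ≤ d := by exact_mod_cast hd3
  have hdC : (d : ℝ) < Clog := (le_max_left _ _).trans_lt hC.max_lt
  have hC4 : (4 : ℝ) < Clog := (le_max_right _ _).trans_lt hC.max_lt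
  obtain ⟨Φ, hΦ, hΦC⟩ := hM.chart y hy
  have hvol := le_euclideanHausdorffMeasure_inter_ball hy (hM.finrank_tangent y hy) (by omega)
    hτ hLM hβ hΦ hΦC (ε := Real.exp (-L) / 16) (by positivity)
  have hmass : ENNReal.ofReal (Real.exp (-Clog)) *
      (μHE[d] : Measure (Amb D)) (M ∩ ball y (Real.exp (-L) / 16)) ≤
      μ (ball y (Real.exp (-L) / 16)) := by
    rw [hp.eq_withDensity, withDensity_apply _ isOpen_ball.measurableSet,
      Measure.restrict_restrict isOpen_ball.measurableSet, Set.inter_comm M]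
    rw [← setLIntegral_const]
    exact setLIntegral_mono' (isOpen_ball.measurableSet.inter hM.isCompact.isClosed.measurableSet)
      fun x hx => ENNReal.ofReal_le_ofReal (hC.lt_density x hx.2).le
  refine le_trans ?_ hmass
  refine le_trans ?_ (mul_le_mul_right hvol _)
  rw [← ENNReal.ofReal_mul (Real.exp_pos _).le]
  apply ENNReal.ofReal_le_ofReal
  set s := min (τ / 8) (Real.exp (-L) / 16 / LM) with hs
  have hs1 : Real.exp (-Clog) * Real.exp (-L) / 16 ≤ s := by
    have h1 : Real.exp (-Clog) ≤ τ := hC.le_min.trans (min_le_left _ _)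
    have h2 : Real.exp (-Clog) ≤ LM⁻¹ := hC.le_min.trans (min_le_right _ _)
    have h3 : Real.exp (-L) ≤ 1 := Real.exp_le_one_iff.2 (by linarith)
    refine le_min ?_ ?_
    · have : Real.exp (-Clog) * Real.exp (-L) ≤ τ * 1 := by gcongr
      linarith
    · rw [div_eq_mul_inv _ LM]
      have : Real.exp (-Clog) * Real.exp (-L) ≤ LM⁻¹ * Real.exp (-L) := by gcongr
      linarith
  have hsd : 0 < Real.sqrt d := Real.sqrt_pos.2 (by linarith)
  have hsqrt : Real.sqrt d ≤ Real.exp Clog := by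
    have h1 : Real.sqrt d ≤ d := by
      rw [Real.sqrt_le_left (by linarith)]
      nlinarith
    have h2 := Real.add_one_le_exp Clog
    linarith
  have h8 : 8 ≤ Real.exp Clog := by
    have h4 : Real.exp 4 ≤ Real.exp Clog := Real.exp_le_exp.2 hC4.le
    have h5 : Real.exp 4 = Real.exp 1 ^ 4 := by rw [← Real.exp_nat_mul]; norm_num
    have h6 : (2 : ℝ) ≤ Real.exp 1 := by linarith [Real.add_one_le_exp (1 : ℝ)]
    have h7 : (2 : ℝ) ^ 4 ≤ Real.exp 1 ^ 4 := by gcongr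
    linarith
  -- One `Clog` pays for `τ` and `LM`, one for `√d`, one for the factor `1/8`. The lower bound on
  -- the density takes the fourth, once rather than `d` times.
  have hbase : Real.exp (-(L + 3 * Clog)) ≤ 2 * s / Real.sqrt d := by
    rw [le_div_iff₀ hsd]
    calc Real.exp (-(L + 3 * Clog)) * Real.sqrt d
        ≤ Real.exp (-(L + 3 * Clog)) * Real.exp Clog := by gcongr
      _ = Real.exp (-Clog) * Real.exp (-L) * (Real.exp Clog)⁻¹ := by
          rw [← Real.exp_neg, ← Real.exp_add, ← Real.exp_add, ← Real.exp_add]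
          congr 1
          ring
      _ ≤ Real.exp (-Clog) * Real.exp (-L) * 8⁻¹ := by gcongr
      _ ≤ 2 * s := by linarith
  calc Real.exp (-(d * (L + 4 * Clog)))
      ≤ Real.exp (-Clog + d * (-(L + 3 * Clog))) := by
        apply Real.exp_le_exp.2
        nlinarith
    _ = Real.exp (-Clog) * Real.exp (-(L + 3 * Clog)) ^ d := by
        rw [Real.exp_add, ← Real.exp_nat_mul]
    _ ≤ _ := by gcongr

/-- A set all of whose points have small neighbourhoods of mass at least `m` under a probability
measure is covered by at most `1 / m` small balls. -/
lemma exists_finset_cover_of_le_measure_ball {X : Type*} [PseudoMetricSpace X] [MeasurableSpace X]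
    [OpensMeasurableSpace X] (μ : Measure X) [IsProbabilityMeasure μ] {A : Set X} {ε m : ℝ}
    (hε : 0 ≤ ε) (hm : 0 < m) (hA : ∀ y ∈ A, ENNReal.ofReal m ≤ μ (ball y (ε / 2))) :
    ∃ T : Finset X, (T.card : ℝ) * m ≤ 1 ∧ ∀ y ∈ A, ∃ c ∈ T, dist y c ≤ ε := by
  classical
  have hcard : ∀ T : Finset X, ↑T ⊆ A → (T : Set X).Pairwise (fun a b => ε < dist a b) →
      (T.card : ℝ) * m ≤ 1 := by
    intro T hTA hT
    have hdis : (T : Set X).PairwiseDisjoint fun c => ball c (ε / 2) := fun a ha b hb hab =>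
      ball_disjoint_ball (by linarith [hT ha hb hab])
    have h1 : ∑ c ∈ T, μ (ball c (ε / 2)) ≤ 1 := by
      rw [← measure_biUnion_finset hdis fun c _ => isOpen_ball.measurableSet]
      exact prob_le_one
    have h2 : (T.card : ℝ≥0∞) * ENNReal.ofReal m ≤ 1 := by
      rw [← nsmul_eq_mul]
      exact (Finset.card_nsmul_le_sum _ _ _ fun c hc => hA c (hTA hc)).trans h1
    rw [← ENNReal.ofReal_natCast, ← ENNReal.ofReal_mul (by positivity)] at h2
    exact ENNReal.ofReal_le_one.1 h2
  -- Cardinalities of `ε`-separated subsets of `A`. Disjointness of the `ε/2`-balls bounds them by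
  -- `1/m`, and a separated set of maximal size is an `ε`-net.
  let P : Set ℕ := {n | ∃ T : Finset X, ↑T ⊆ A ∧
    (T : Set X).Pairwise (fun a b => ε < dist a b) ∧ T.card = n}
  have hPne : P.Nonempty := ⟨0, ∅, by simp, by simp, rfl⟩
  have hPbd : BddAbove P := by
    refine ⟨⌊m⁻¹⌋₊, ?_⟩
    rintro n ⟨T, hTA, hT, rfl⟩
    apply Nat.le_floor
    rw [← one_div, le_div_iff₀ hm]
    exact hcard T hTA hT
  obtain ⟨T, hTA, hT, hTn⟩ := Nat.sSup_mem hPne hPbd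
  refine ⟨T, hcard T hTA hT, fun y hy => ?_⟩
  by_contra! hno
  have hyT : y ∉ T := fun h => (hno y h).not_ge (by simpa using hε)
  have hmem : T.card + 1 ∈ P := by
    refine ⟨insert y T, ?_, ?_, Finset.card_insert_of_notMem hyT⟩
    · rw [Finset.coe_insert]
      exact Set.insert_subset hy hTA
    · rw [Finset.coe_insert]
      refine hT.insert fun b hb _ => ⟨hno b hb, ?_⟩
      rw [dist_comm]
      exact hno b hb
  have := le_csSup hPbd hmem
  omega

end Volume

/-! ### Posterior tail mass and the shift of the posterior mean -/

section Posterior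

open scoped RealInnerProductSpace

lemma integrable_of_continuous_of_ae_mem_isCompact {E : Type*} [TopologicalSpace E]
    [MeasurableSpace E] [OpensMeasurableSpace E] {F : Type*} [NormedAddCommGroup F]
    [SecondCountableTopologyEither E F] {μ : Measure E} [IsFiniteMeasure μ] {M : Set E}
    (hM : IsCompact M) (hμ : ∀ᵐ y ∂μ, y ∈ M) {f : E → F} (hf : Continuous f) :
    Integrable f μ := by
  obtain ⟨b, hb⟩ := hM.exists_bound_of_continuousOn hf.continuousOn
  exact Integrable.of_bound hf.aestronglyMeasurable b (hμ.mono hb)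

variable {E : Type*} [NormedAddCommGroup E] [InnerProductSpace ℝ E]
  [MeasurableSpace E] [BorelSpace E] {μ : Measure E} [IsProbabilityMeasure μ] {M : Set E}

lemma integrable_relWeight (hM : IsCompact M) (hμ : ∀ᵐ y ∂μ, y ∈ M) (ρ : ℝ) (x₀ z : E) :
    Integrable (relWeight ρ x₀ z) μ :=
  integrable_of_continuous_of_ae_mem_isCompact hM hμ (continuous_relWeight_right ρ x₀ z)

lemma integral_relWeight_pos (hM : IsCompact M) (hμ : ∀ᵐ y ∂μ, y ∈ M) (ρ : ℝ) (x₀ z : E) :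
    0 < ∫ y, relWeight ρ x₀ z y ∂μ := by
  rw [integral_pos_iff_support_of_nonneg (fun y => (relWeight_pos ρ x₀ z y).le)
    (integrable_relWeight hM hμ ρ x₀ z)]
  have : Function.support (relWeight ρ x₀ z) = Set.univ :=
    Set.eq_univ_of_forall fun y => (relWeight_pos ρ x₀ z y).ne'
  rw [this, measure_univ]
  exact one_pos

/-- Off the exceptional event, the unnormalised posterior mass of the complement of a ball is at
most `η` times the total one. -/
lemma setIntegral_relWeight_le_of_not_lt (hM : IsCompact M) (hμ : ∀ᵐ y ∂μ, y ∈ M) {ρ η r : ℝ}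
    (hη : 0 ≤ η) {x₀ z : E}
    (h : ¬ ENNReal.ofReal η * ∫⁻ y, ENNReal.ofReal (relWeight ρ x₀ z y) ∂μ <
        ∫⁻ y in {y | r < ‖y - x₀‖}, ENNReal.ofReal (relWeight ρ x₀ z y) ∂μ) :
    ∫ y in {y | r < ‖y - x₀‖}, relWeight ρ x₀ z y ∂μ ≤ η * ∫ y, relWeight ρ x₀ z y ∂μ := by
  have hint := integrable_relWeight hM hμ ρ x₀ z
  have hpos := integral_relWeight_pos hM hμ ρ x₀ z
  have hnn : ∀ ν : Measure E, 0 ≤ᵐ[ν] relWeight ρ x₀ z :=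
    fun ν => ae_of_all _ fun y => (relWeight_pos ρ x₀ z y).le
  rw [not_lt, ← ofReal_integral_eq_lintegral_ofReal hint (hnn _),
    ← ofReal_integral_eq_lintegral_ofReal hint.integrableOn (hnn _),
    ← ENNReal.ofReal_mul hη] at h
  exact (ENNReal.ofReal_le_ofReal_iff (by positivity)).1 h

/-- The displacement of the posterior mean from `x₀`. -/
noncomputable def postShift (μ : Measure E) (ρ : ℝ) (x₀ z : E) : E :=
  (∫ y, relWeight ρ x₀ z y ∂μ)⁻¹ • ∫ y, relWeight ρ x₀ z y • (y - x₀) ∂μ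

lemma stronglyMeasurable_postShift [FiniteDimensional ℝ E] (ρ : ℝ) (x₀ : E) :
    StronglyMeasurable (postShift μ ρ x₀) := by
  have hc := continuous_relWeight ρ x₀
  have h1 : StronglyMeasurable fun z => ∫ y, relWeight ρ x₀ z y ∂μ :=
    StronglyMeasurable.integral_prod_right hc.stronglyMeasurable
  have h2 : StronglyMeasurable fun z => ∫ y, relWeight ρ x₀ z y • (y - x₀) ∂μ := by
    refine StronglyMeasurable.integral_prod_right (Continuous.stronglyMeasurable ?_)
    exact hc.smul (by fun_prop : Continuous fun q : E × E => q.2 - x₀)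
  exact h1.measurable.inv.stronglyMeasurable.smul h2

/-- Points within `r` displace the mean by at most `r`. The others have displacement at most one and
relative mass at most `η`. -/
lemma norm_postShift_le_of_setIntegral_le [FiniteDimensional ℝ E] (hM : IsCompact M) (hμ : ∀ᵐ y ∂μ, y ∈ M) {ρ η r : ℝ}
    (hr : 0 ≤ r) {x₀ z : E} (hM1 : ∀ y ∈ M, ‖y - x₀‖ ≤ 1)
    (h : ∫ y in {y | r < ‖y - x₀‖}, relWeight ρ x₀ z y ∂μ ≤ η * ∫ y, relWeight ρ x₀ z y ∂μ) :
    ‖postShift μ ρ x₀ z‖ ≤ r + η := by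
  have hint := integrable_relWeight hM hμ ρ x₀ z
  have hpos := integral_relWeight_pos hM hμ ρ x₀ z
  have hSm : MeasurableSet {y | r < ‖y - x₀‖} :=
    (isOpen_lt (by fun_prop) (by fun_prop)).measurableSet
  rw [postShift, norm_smul, norm_inv, Real.norm_of_nonneg hpos.le, inv_mul_le_iff₀ hpos]
  calc ‖∫ y, relWeight ρ x₀ z y • (y - x₀) ∂μ‖
      ≤ ∫ y, (r * relWeight ρ x₀ z y +
        {y | r < ‖y - x₀‖}.indicator (relWeight ρ x₀ z) y) ∂μ := by
        refine norm_integral_le_of_norm_le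
          ((hint.const_mul r).add (hint.indicator hSm)) (hμ.mono fun y hy => ?_)
        have hw := (relWeight_pos ρ x₀ z y).le
        rw [norm_smul, Real.norm_of_nonneg hw]
        by_cases hyr : r < ‖y - x₀‖
        · rw [Set.indicator_of_mem (show y ∈ {y | r < ‖y - x₀‖} from hyr)]
          nlinarith [hM1 y hy, mul_nonneg hr hw]
        · rw [Set.indicator_of_notMem (show y ∉ {y | r < ‖y - x₀‖} from hyr)]
          nlinarith [not_lt.1 hyr]
    _ = r * ∫ y, relWeight ρ x₀ z y ∂μ + ∫ y in {y | r < ‖y - x₀‖}, relWeight ρ x₀ z y ∂μ := by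
        rw [integral_add (hint.const_mul r) (hint.indicator hSm), integral_const_mul,
          integral_indicator hSm]
    _ ≤ _ := by linarith

lemma norm_postShift_le_one [FiniteDimensional ℝ E] (hM : IsCompact M) (hμ : ∀ᵐ y ∂μ, y ∈ M) (ρ : ℝ)
    {x₀ : E} (hM1 : ∀ y ∈ M, ‖y - x₀‖ ≤ 1) (z : E) : ‖postShift μ ρ x₀ z‖ ≤ 1 := by
  -- Radius `1` already captures all of `M`, so no mass is left outside.
  have h := norm_postShift_le_of_setIntegral_le (ρ := ρ) (η := 0) (z := z) hM hμ zero_le_one hM1 ?_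
  · simpa using h
  · have : μ {y | 1 < ‖y - x₀‖} = 0 :=
      measure_eq_zero_iff_ae_notMem.2 (hμ.mono fun y hy => (hM1 y hy).not_gt)
    simp [Measure.restrict_eq_zero.2 this]

end Posterior

/-! ### Tweedie's formula -/

section Score

open scoped RealInnerProductSpace

lemma cc_pos (t : ℝ) : 0 < cc t := Real.exp_pos _

lemma sg_pos {t : ℝ} (ht : 0 < t) : 0 < sg t := by
  apply Real.sqrt_pos.2
  have : Real.exp (-2 * t) < 1 := by rw [Real.exp_lt_one_iff]; linarith
  linarith

variable {D : ℕ} {M : Set (Amb D)} {μ : Measure (Amb D)}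

/-- Expanding the square isolates a factor free of `y`, which cancels in every posterior ratio. -/
lemma gaussWeight_fwd {t : ℝ} (ht : 0 < t) (x₀ z y : Amb D) :
    gaussWeight t (fwd t x₀ z) y = Real.exp (-‖z‖ ^ 2 / 2) * relWeight (cc t / sg t) x₀ z y := by
  have hs := sg_pos ht
  rw [gaussWeight, relWeight, ← Real.exp_add]
  congr 1
  have : fwd t x₀ z - cc t • y = cc t • (x₀ - y) + sg t • z := by
    rw [fwd, smul_sub]
    abel
  rw [this, norm_add_sq_real, norm_smul, norm_smul, inner_smul_left, inner_smul_right,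
    Real.norm_of_nonneg hs.le, Real.norm_of_nonneg (cc_pos t).le]
  simp only [conj_trivial]
  field_simp
  ring

lemma continuous_gaussWeight (t : ℝ) (x : Amb D) : Continuous (gaussWeight t x) := by
  unfold gaussWeight
  fun_prop

lemma hasFDerivAt_gaussWeight (t : ℝ) (x y : Amb D) :
    HasFDerivAt (fun x => gaussWeight t x y)
      (innerSL ℝ ((-(gaussWeight t x y / sg t ^ 2)) • (x - cc t • y))) x := by
  have h1 : HasFDerivAt (fun x : Amb D => x - cc t • y) (ContinuousLinearMap.id ℝ (Amb D)) x :=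
    (hasFDerivAt_id x).sub_const _
  have h2 := ((h1.norm_sq).neg.mul_const (2 * sg t ^ 2)⁻¹).exp
  refine h2.congr_fderiv ?_
  ext v
  simp only [gaussWeight, div_eq_mul_inv]
  simp
  ring

/-- Differentiation under the integral: the weight is at most one and `M` is bounded, so on a unit
ball around `x` the derivative has a constant majorant. -/
lemma hasFDerivAt_marginal [IsProbabilityMeasure μ] (hM : IsCompact M)
    (hμ : ∀ᵐ y ∂μ, y ∈ M) (t : ℝ) (x : Amb D) :
    HasFDerivAt (marginal μ t)
      (innerSL ℝ (∫ y, (-(gaussWeight t x y / sg t ^ 2)) • (x - cc t • y) ∂μ)) x := by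
  obtain ⟨R, hR⟩ := hM.isBounded.exists_norm_le
  have hc : ∀ x, Continuous fun y => (-(gaussWeight t x y / sg t ^ 2)) • (x - cc t • y) := fun x =>
    have h : Continuous fun y : Amb D => x - cc t • y := by fun_prop
    ((continuous_gaussWeight t x).div_const _).neg.smul h
  rw [← ContinuousLinearMap.integral_comp_comm _
    (integrable_of_continuous_of_ae_mem_isCompact hM hμ (hc x))]
  refine hasFDerivAt_integral_of_dominated_of_fderiv_le (𝕜 := ℝ) (s := ball x 1)
    (bound := fun _ => (1 / sg t ^ 2) * (‖x‖ + 1 + cc t * R))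
    (F' := fun x y => innerSL ℝ ((-(gaussWeight t x y / sg t ^ 2)) • (x - cc t • y)))
    (ball_mem_nhds x one_pos)
    (Filter.Eventually.of_forall fun x => (continuous_gaussWeight t x).aestronglyMeasurable)
    (integrable_of_continuous_of_ae_mem_isCompact hM hμ (continuous_gaussWeight t x))
    ((innerSL ℝ).continuous.comp (hc x)).aestronglyMeasurable ?_ (integrable_const _)
    (ae_of_all _ fun y x' _ => hasFDerivAt_gaussWeight t x' y)
  refine hμ.mono fun y hy x' hx' => ?_
  have hw0 : 0 ≤ gaussWeight t x' y := (Real.exp_pos _).le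
  have hw1 : gaussWeight t x' y ≤ 1 := by
    apply Real.exp_le_one_iff.2
    rw [neg_div]
    have : 0 ≤ ‖x' - cc t • y‖ ^ 2 / (2 * sg t ^ 2) := by positivity
    linarith
  rw [innerSL_apply_norm, norm_smul, norm_neg, Real.norm_of_nonneg (by positivity)]
  gcongr
  refine (norm_sub_le _ _).trans ?_
  rw [norm_smul, Real.norm_of_nonneg (cc_pos t).le]
  have h1 : ‖x'‖ ≤ ‖x‖ + 1 := by
    have h2 : ‖x' - x‖ < 1 := by simpa [dist_eq_norm] using hx'
    have h3 : ‖x'‖ ≤ ‖x‖ + ‖x' - x‖ := norm_le_norm_add_norm_sub' _ _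
    linarith
  have := cc_pos t
  gcongr
  exact hR y hy

/-- Tweedie's formula: the error of the score as a denoiser is the rescaled displacement of the
posterior mean. -/
lemma sg_smul_score_add [IsProbabilityMeasure μ] (hM : IsCompact M) (hμ : ∀ᵐ y ∂μ, y ∈ M)
    {t : ℝ} (ht : 0 < t) (x₀ z : Amb D) :
    sg t • score μ t (fwd t x₀ z) + z = (cc t / sg t) • postShift μ (cc t / sg t) x₀ z := by
  have hs := sg_pos ht
  set ρ := cc t / sg t with hρ
  set x := fwd t x₀ z with hx
  set g := Real.exp (-‖z‖ ^ 2 / 2) with hg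
  have hg0 : 0 < g := Real.exp_pos _
  have hJ := integral_relWeight_pos hM hμ ρ x₀ z
  set J := ∫ y, relWeight ρ x₀ z y ∂μ with hJdef
  have hint := integrable_relWeight hM hμ ρ x₀ z
  have hint2 : Integrable (fun y => relWeight ρ x₀ z y • (y - x₀)) μ :=
    integrable_of_continuous_of_ae_mem_isCompact hM hμ
      ((continuous_relWeight_right ρ x₀ z).smul (by fun_prop))
  have hmarg : marginal μ t x = g * J := by
    simp only [marginal, hx, gaussWeight_fwd ht]
    rw [integral_const_mul]
  have hgrad : ∫ y, (-(gaussWeight t x y / sg t ^ 2)) • (x - cc t • y) ∂μ =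
      (g * cc t / sg t ^ 2) • (∫ y, relWeight ρ x₀ z y • (y - x₀) ∂μ) - (g * J / sg t) • z := by
    have hpt : ∀ y, (-(gaussWeight t x y / sg t ^ 2)) • (x - cc t • y) =
        (g * cc t / sg t ^ 2) • relWeight ρ x₀ z y • (y - x₀) -
          (g / sg t * relWeight ρ x₀ z y) • z := by
      intro y
      have : x - cc t • y = sg t • z - cc t • (y - x₀) := by
        rw [hx, fwd, smul_sub]
        abel
      have hgw : gaussWeight t x y = g * relWeight ρ x₀ z y := gaussWeight_fwd ht x₀ z y
      rw [this, hgw]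
      match_scalars <;> field_simp
    simp_rw [hpt]
    have h1 : Integrable (fun y => (g * cc t / sg t ^ 2) • relWeight ρ x₀ z y • (y - x₀)) μ :=
      hint2.fun_smul _
    have h2 : Integrable (fun y => (g / sg t * relWeight ρ x₀ z y) • z) μ :=
      (hint.const_mul _).smul_const z
    rw [integral_sub h1 h2, integral_smul, integral_smul_const, integral_const_mul,
      mul_div_right_comm g J]
  have hscore : score μ t x = (g * J)⁻¹ •
      ∫ y, (-(gaussWeight t x y / sg t ^ 2)) • (x - cc t • y) ∂μ := by
    apply HasGradientAt.gradient
    rw [hasGradientAt_iff_hasFDerivAt]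
    have h := (hasFDerivAt_marginal hM hμ t x).log (by rw [hmarg]; positivity)
    refine h.congr_fderiv ?_
    rw [hmarg]
    ext v
    simp
  rw [hscore, hgrad, postShift, ← hJdef, hρ]
  match_scalars
  · field_simp
  · field_simp
    ring

end Score

/-! ### Choice of scales, posterior concentration and score bounds -/

section Concentration

variable {D d : ℕ} {M : Set (Amb D)} {τ LM Clog τmin pmin pmax Lμ : ℝ} {α β : ℕ}
  {p : Amb D → ℝ} {μ : Measure (Amb D)}

lemma logInvRatio_nonneg (t : ℝ) : 0 ≤ logInvRatio t := le_max_right _ _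

lemma cc_div_sg_le_exp {t : ℝ} (ht : 0 < t) : cc t / sg t ≤ Real.exp (logInvRatio t) := by
  have h : 0 < cc t / sg t := div_pos (cc_pos t) (sg_pos ht)
  rw [← Real.log_le_iff_le_exp h, ← inv_div]
  exact le_max_left _ _

lemma IsLogComplexity.le_dim_mul (hM : IsRegularManifold β d τmin τ LM M)
    (hC : IsLogComplexity d τ LM Clog M p) {L : ℝ} (hL : 0 ≤ L) :
    960 ≤ 20 * d * (L + 4 * Clog) := by
  have hd3 : (3 : ℝ) ≤ d := by exact_mod_cast hM.three_le_dim
  have hC4 : (4 : ℝ) < Clog := (le_max_right _ _).trans_lt hC.max_lt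
  have : (3 : ℝ) * 16 ≤ d * (L + 4 * Clog) := by gcongr; linarith
  linarith

lemma log_inv_nonneg {δ : ℝ} (hδ : 0 < δ) (hδ1 : δ ≤ 1) : 0 ≤ Real.log δ⁻¹ :=
  Real.log_nonneg ((one_le_inv₀ hδ).2 hδ1)

lemma mul_radius (d : ℕ) (Clog : ℝ) {t δ η : ℝ} (ht : 0 < t) :
    cc t / sg t * radius d Clog t δ η = 2 * Real.sqrt
      (20 * d * (logInvRatio t + 4 * Clog) + 8 * Real.log δ⁻¹ + Real.log η⁻¹) := by
  have := cc_pos t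
  have := sg_pos ht
  rw [radius]
  field_simp

/-- Concentration of the unnormalised posterior around the starting point. -/
lemma stdGaussian_relWeight_radius_le [IsProbabilityMeasure μ] (hβ : 1 ≤ β)
    (hM : IsRegularManifold β d τmin τ LM M) (hp : HasRegularDensity α d τ pmin pmax Lμ M p μ)
    (hC : IsLogComplexity d τ LM Clog M p) {t δ η : ℝ} (ht : 0 < t) (hδ : 0 < δ) (hδ1 : δ ≤ 1)
    (hη : 0 < η) (hη1 : η ≤ 1) {x₀ : Amb D} (hx₀ : x₀ ∈ M) :
    stdGaussian (Amb D) {z | ENNReal.ofReal η *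
          ∫⁻ y, ENNReal.ofReal (relWeight (cc t / sg t) x₀ z y) ∂μ <
        ∫⁻ y in {y | radius d Clog t δ η < ‖y - x₀‖},
          ENNReal.ofReal (relWeight (cc t / sg t) x₀ z y) ∂μ} ≤ ENNReal.ofReal δ := by
  set L := logInvRatio t with hL
  have hL0 : 0 ≤ L := logInvRatio_nonneg t
  have hρ : 0 < cc t / sg t := div_pos (cc_pos t) (sg_pos ht)
  have hρL := cc_div_sg_le_exp ht
  rw [← hL] at hρL
  have hX := hC.le_dim_mul hM hL0
  set X := d * (L + 4 * Clog) with hXdef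
  have hlδ := log_inv_nonneg hδ hδ1
  have hlη := log_inv_nonneg hη hη1
  -- The net scale is `ε = exp(-L) / 8`, so that `ρ ε ≤ 1/8`; the packing argument needs the mass at
  -- radius `ε / 2`.
  have hball : ∀ y ∈ M, ENNReal.ofReal (Real.exp (-X)) ≤ μ (ball y (Real.exp (-L) / 8 / 2)) := by
    intro y hy
    rw [div_div]
    norm_num
    exact le_measure_ball hβ hM hp hC hL0 hy
  obtain ⟨T, hTc, hT⟩ := exists_finset_cover_of_le_measure_ball μ (by positivity)
    (Real.exp_pos (-X)) hball
  have hρε : cc t / sg t * (Real.exp (-L) / 8) ≤ 1 / 8 := by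
    have h : cc t / sg t * Real.exp (-L) ≤ Real.exp L * Real.exp (-L) := by gcongr
    rw [← Real.exp_add, add_neg_cancel, Real.exp_zero] at h
    linarith
  set Q := 20 * d * (L + 4 * Clog) + 8 * Real.log δ⁻¹ + Real.log η⁻¹ with hQ
  have hQX : Q = 20 * X + 8 * Real.log δ⁻¹ + Real.log η⁻¹ := by rw [hQ, hXdef]; ring
  have hX' : 960 ≤ 20 * X := by rw [hXdef]; linarith
  have hρr : cc t / sg t * radius d Clog t δ η = 2 * Real.sqrt Q := mul_radius d Clog ht
  have hρr60 : 60 ≤ cc t / sg t * radius d Clog t δ η := by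
    rw [hρr]
    have : (30 : ℝ) ≤ Real.sqrt Q := Real.le_sqrt_of_sq_le (by linarith)
    linarith
  refine (stdGaussian_relWeight_tail_le μ x₀ T hρ hρε hρr60 hη (Real.exp_pos (-X))
    ((hp.ae_mem hM).mono hT) ((hball x₀ hx₀).trans (measure_mono ?_))).trans ?_
  · exact (ball_subset_ball (by linarith [Real.exp_pos (-L)])).trans ball_subset_closedBall
  apply ENNReal.ofReal_le_ofReal
  have hTX : (T.card : ℝ) ≤ Real.exp X := by
    rw [Real.exp_neg, ← div_eq_mul_inv, div_le_one (Real.exp_pos X)] at hTc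
    exact hTc
  have hη_exp : η = Real.exp (-Real.log η⁻¹) := by
    rw [Real.log_inv, neg_neg, Real.exp_log hη]
  have hδ_exp : δ = Real.exp (-Real.log δ⁻¹) := by
    rw [Real.log_inv, neg_neg, Real.exp_log hδ]
  have hsq : (cc t / sg t * radius d Clog t δ η) ^ 2 = 4 * Q := by
    rw [hρr, mul_pow, Real.sq_sqrt (by linarith)]
    norm_num
  have hηm : (η * Real.exp (-X)) ^ (1 / 8 : ℝ) =
      Real.exp (-(Real.log η⁻¹ + X) / 8) := by
    nth_rw 1 [hη_exp]
    rw [← Real.exp_add, ← Real.exp_mul]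
    congr 1
    ring
  rw [hsq, hηm, mul_div_assoc, ← Real.exp_sub]
  -- In the exponent, `Q / 6` has to cover `X` from the net, `(X + log η⁻¹) / 8` from the
  -- normaliser, and `log δ⁻¹`. The weights `20`, `8`, `1` in `Q` suffice.
  calc (T.card : ℝ) * Real.exp (-(4 * Q) / 24 - -(Real.log η⁻¹ + X) / 8)
      ≤ Real.exp X * Real.exp (-(4 * Q) / 24 - -(Real.log η⁻¹ + X) / 8) := by gcongr
    _ ≤ δ := by
      rw [← Real.exp_add]
      refine le_of_le_of_eq ?_ hδ_exp.symm
      apply Real.exp_le_exp.2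
      rw [hQX]
      linarith

lemma ofReal_one_sub_le_of_compl_subset {Ω : Type*} [MeasurableSpace Ω] {P : Measure Ω}
    [IsProbabilityMeasure P] {A B : Set Ω} {δ : ℝ} (hδ : 0 ≤ δ) (h : Aᶜ ⊆ B)
    (hB : P B ≤ ENNReal.ofReal δ) : ENNReal.ofReal (1 - δ) ≤ P A := by
  rw [ENNReal.ofReal_sub _ hδ, ENNReal.ofReal_one, tsub_le_iff_right]
  calc (1 : ℝ≥0∞) = P Set.univ := measure_univ.symm
    _ ≤ P (A ∪ B) := measure_mono fun z _ => or_iff_not_imp_left.2 fun hz => h hz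
    _ ≤ P A + P B := measure_union_le _ _
    _ ≤ _ := by gcongr

/-- Integrals of the posterior density in terms of the data distribution. -/
lemma setIntegral_posteriorDensity (hM : IsRegularManifold β d τmin τ LM M)
    (hp : HasRegularDensity α d τ pmin pmax Lμ M p μ) {t : ℝ} (ht : 0 < t) (x₀ z : Amb D)
    {A : Set (Amb D)} (hA : MeasurableSet A) :
    ∫ y in A ∩ M, posteriorDensity d M p t (fwd t x₀ z) y ∂(μHE[d] : Measure (Amb D)) =
      (∫ y in A, relWeight (cc t / sg t) x₀ z y ∂μ) / ∫ y, relWeight (cc t / sg t) x₀ z y ∂μ := by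
  set x := fwd t x₀ z with hx
  have hMm := hM.isCompact.isClosed.measurableSet
  have hpm := hp.aemeasurable hM
  have key : ∀ B, MeasurableSet B →
      ∫ y in B ∩ M, gaussWeight t x y * p y ∂(μHE[d] : Measure (Amb D)) =
        Real.exp (-‖z‖ ^ 2 / 2) * ∫ y in B, relWeight (cc t / sg t) x₀ z y ∂μ := by
    intro B hB
    rw [← integral_const_mul]
    simp_rw [← gaussWeight_fwd ht]
    rw [hp.eq_withDensity, setIntegral_withDensity_eq_setIntegral_toReal_smul₀
      (hpm.ennreal_ofReal.mono_measure Measure.restrict_le_self)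
      (ae_of_all _ fun _ => ENNReal.ofReal_lt_top) _ hB, Measure.restrict_restrict hB]
    refine setIntegral_congr_fun (hB.inter hMm) fun y hy => ?_
    have : 0 ≤ p y := hp.pmin_pos.le.trans (hp.pmin_le y hy.2)
    simp only [ENNReal.toReal_ofReal this, smul_eq_mul]
    rw [mul_comm]
  simp only [posteriorDensity]
  rw [integral_div, key A hA]
  have huniv := key Set.univ MeasurableSet.univ
  rw [Set.univ_inter, setIntegral_univ] at huniv
  rw [huniv, mul_div_mul_left _ _ (Real.exp_pos _).ne']

/-- High-probability concentration of the posterior around the starting point. -/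
lemma posterior_concentration [IsProbabilityMeasure μ] (hβ : 1 ≤ β)
    (hM : IsRegularManifold β d τmin τ LM M) (hp : HasRegularDensity α d τ pmin pmax Lμ M p μ)
    (hC : IsLogComplexity d τ LM Clog M p) {t δ η : ℝ} (ht : 0 < t) (hδ : 0 < δ)
    (hη : 0 < η) {x₀ : Amb D} (hx₀ : x₀ ∈ M) :
    ENNReal.ofReal (1 - δ) ≤ stdGaussian (Amb D)
      {z | 1 - η ≤ ∫ y in {y | y ∈ M ∧ ‖y - x₀‖ ≤ radius d Clog t δ η},
        posteriorDensity d M p t (fwd t x₀ z) y ∂(μHE[d] : Measure (Amb D))} := by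
  rcases le_total 1 δ with hδ1 | hδ1
  · rw [ENNReal.ofReal_of_nonpos (by linarith)]
    exact zero_le
  have hμ := hp.ae_mem hM
  set r := radius d Clog t δ η
  set ρ := cc t / sg t
  have hAm : MeasurableSet {y : Amb D | ‖y - x₀‖ ≤ r} :=
    (isClosed_le (by fun_prop) (by fun_prop)).measurableSet
  have hset : {y | y ∈ M ∧ ‖y - x₀‖ ≤ r} = {y | ‖y - x₀‖ ≤ r} ∩ M := by
    ext y
    exact and_comm
  simp_rw [hset, setIntegral_posteriorDensity hM hp ht x₀ _ hAm]
  rcases le_total 1 η with hη1 | hη1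
  · rw [Set.eq_univ_of_forall (s := {z | 1 - η ≤ _}) fun z => ?_, measure_univ]
    · rw [← ENNReal.ofReal_one]
      exact ENNReal.ofReal_le_ofReal (by linarith)
    · refine (by linarith : 1 - η ≤ 0).trans (div_nonneg ?_ ?_) <;>
        exact integral_nonneg fun y => (relWeight_pos ρ x₀ z y).le
  refine ofReal_one_sub_le_of_compl_subset hδ.le (fun z hz => ?_)
    (stdGaussian_relWeight_radius_le hβ hM hp hC ht hδ hδ1 hη hη1 hx₀)
  by_contra hnot
  have h := setIntegral_relWeight_le_of_not_lt hM.isCompact hμ hη.le hnot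
  apply hz
  have hpos := integral_relWeight_pos hM.isCompact hμ ρ x₀ z
  have hadd := integral_add_compl hAm (integrable_relWeight hM.isCompact hμ ρ x₀ z)
  have hcompl : {y : Amb D | ‖y - x₀‖ ≤ r}ᶜ = {y | r < ‖y - x₀‖} := by
    ext y
    simp
  rw [hcompl] at hadd
  change 1 - η ≤ _
  rw [le_div_iff₀ hpos]
  linarith

/-- A tail bound for the error of the score. -/
lemma stdGaussian_score_tail_le [IsProbabilityMeasure μ] (hβ : 1 ≤ β)
    (hM : IsRegularManifold β d τmin τ LM M) (hp : HasRegularDensity α d τ pmin pmax Lμ M p μ)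
    (hC : IsLogComplexity d τ LM Clog M p) (hdiam : Metric.diam M ≤ 1) {t δ : ℝ} (ht : 0 < t)
    (hδ : 0 < δ) (hδ1 : δ ≤ 1) {x₀ : Amb D} (hx₀ : x₀ ∈ M) :
    stdGaussian (Amb D) {z | 4 * Real.sqrt (20 * d * (2 * logInvRatio t + 4 * Clog) +
      8 * Real.log δ⁻¹) < ‖sg t • score μ t (fwd t x₀ z) + z‖} ≤ ENNReal.ofReal δ := by
  have hμ := hp.ae_mem hM
  set L := logInvRatio t with hL
  have hL0 : 0 ≤ L := logInvRatio_nonneg t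
  have hη1 : Real.exp (-L) ≤ 1 := Real.exp_le_one_iff.2 (by linarith)
  -- With `η = exp(-L)` the far mass contributes at most `ρ η ≤ 1`, while `log η⁻¹ = L` is absorbed
  -- by doubling `L` under the root.
  refine (measure_mono fun z hz => ?_).trans (stdGaussian_relWeight_radius_le hβ hM hp hC ht hδ hδ1
    (Real.exp_pos (-L)) hη1 hx₀)
  by_contra hnot
  have h := setIntegral_relWeight_le_of_not_lt hM.isCompact hμ (Real.exp_pos (-L)).le hnot
  have hM1 : ∀ y ∈ M, ‖y - x₀‖ ≤ 1 := fun y hy => by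
    rw [← dist_eq_norm]
    exact (dist_le_diam_of_mem hM.isCompact.isBounded hy hx₀).trans hdiam
  have hcs : 0 < cc t / sg t := div_pos (cc_pos t) (sg_pos ht)
  have hr : 0 ≤ radius d Clog t δ (Real.exp (-L)) := by
    have := cc_pos t
    have := sg_pos ht
    rw [radius]
    positivity
  have hnorm := norm_postShift_le_of_setIntegral_le hM.isCompact hμ hr hM1 h
  refine absurd (show 4 * Real.sqrt _ < ‖sg t • score μ t (fwd t x₀ z) + z‖ from hz)
    (not_lt.2 ?_)
  rw [sg_smul_score_add hM.isCompact hμ ht, norm_smul, Real.norm_of_nonneg hcs.le]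
  have hlδ := log_inv_nonneg hδ hδ1
  have hρη : cc t / sg t * Real.exp (-L) ≤ 1 := by
    have h : cc t / sg t * Real.exp (-L) ≤ Real.exp L * Real.exp (-L) := by
      gcongr
      exact cc_div_sg_le_exp ht
    rwa [← Real.exp_add, add_neg_cancel, Real.exp_zero] at h
  have hX := hC.le_dim_mul hM hL0
  have hd3 : (3 : ℝ) ≤ d := by exact_mod_cast hM.three_le_dim
  set Q := 20 * d * (2 * L + 4 * Clog) + 8 * Real.log δ⁻¹ with hQ
  have hQL : 20 * d * (L + 4 * Clog) + 8 * Real.log δ⁻¹ + L ≤ Q := by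
    rw [hQ]
    nlinarith
  have hQ1 : 1 ≤ Real.sqrt Q := Real.one_le_sqrt.2 (by linarith)
  calc cc t / sg t * ‖postShift μ (cc t / sg t) x₀ z‖
      ≤ cc t / sg t * (radius d Clog t δ (Real.exp (-L)) + Real.exp (-L)) := by gcongr
    _ = 2 * Real.sqrt (20 * d * (L + 4 * Clog) + 8 * Real.log δ⁻¹ + L) +
        cc t / sg t * Real.exp (-L) := by
        rw [mul_add, mul_radius d Clog ht, ← Real.exp_neg, neg_neg, Real.log_exp]
    _ ≤ 2 * Real.sqrt Q + 1 := by gcongr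
    _ ≤ 4 * Real.sqrt Q := by linarith

/-- A nonnegative variable whose excess over `a` has an exponential tail of scale `b` has mean at
most `a + b`. -/
lemma integral_le_of_exp_tail {Ω : Type*} [MeasurableSpace Ω] {P : Measure Ω}
    [IsProbabilityMeasure P] {Y : Ω → ℝ} (hY : Integrable Y P) {a b : ℝ} (hb : 0 < b)
    (h : ∀ v, 0 < v → P {ω | a + v < Y ω} ≤ ENNReal.ofReal (Real.exp (-v / b))) :
    ∫ ω, Y ω ∂P ≤ a + b := by
  have hexc : Integrable (fun ω => max (Y ω - a) 0) P := (hY.sub (integrable_const a)).pos_part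
  have h1 : ∫ ω, Y ω ∂P ≤ a + ∫ ω, max (Y ω - a) 0 ∂P := by
    have : ∫ ω, (a + max (Y ω - a) 0) ∂P = a + ∫ ω, max (Y ω - a) 0 ∂P := by
      rw [integral_add (integrable_const a) hexc]
      simp
    rw [← this]
    exact integral_mono hY ((integrable_const a).add hexc) fun ω => by
      have := le_max_left (Y ω - a) 0
      simp only
      linarith
  have hneg : -b⁻¹ < 0 := by simpa using hb
  have h2 : ENNReal.ofReal (∫ ω, max (Y ω - a) 0 ∂P) ≤ ENNReal.ofReal b := by
    rw [ofReal_integral_eq_lintegral_ofReal hexc (ae_of_all _ fun _ => le_max_right _ _),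
      lintegral_eq_lintegral_meas_lt (f := fun ω => max (Y ω - a) 0) _
        (ae_of_all _ fun _ => le_max_right _ _) hexc.aestronglyMeasurable.aemeasurable]
    calc ∫⁻ v in Set.Ioi 0, P {ω | v < max (Y ω - a) 0}
        ≤ ∫⁻ v in Set.Ioi 0, ENNReal.ofReal (Real.exp (-b⁻¹ * v)) := by
          refine setLIntegral_mono' measurableSet_Ioi fun v hv => ?_
          have hv : 0 < v := hv
          rw [show -b⁻¹ * v = -v / b by field_simp]
          refine (measure_mono fun ω hω => ?_).trans (h v hv)
          rcases lt_max_iff.1 (show v < max (Y ω - a) 0 from hω) with h' | h'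
          · change a + v < Y ω
            linarith
          · exact absurd h' hv.not_gt
      _ = ENNReal.ofReal b := by
          rw [← ofReal_integral_eq_lintegral_ofReal (integrableOn_exp_mul_Ioi hneg 0)
            (ae_of_all _ fun _ => (Real.exp_pos _).le), integral_exp_mul_Ioi hneg]
          simp
  have h3 := (ENNReal.ofReal_le_ofReal_iff hb.le).1 h2
  linarith

/-- By Tweedie's formula and `diam M ≤ 1` the error is bounded by `ρ`, uniformly in the noise. -/
lemma integrable_norm_score_sq [IsProbabilityMeasure μ] (hM : IsCompact M)
    (hμ : ∀ᵐ y ∂μ, y ∈ M) (hdiam : Metric.diam M ≤ 1) {t : ℝ} (ht : 0 < t) {x₀ : Amb D}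
    (hx₀ : x₀ ∈ M) :
    Integrable (fun z => ‖sg t • score μ t (fwd t x₀ z) + z‖ ^ 2) (stdGaussian (Amb D)) := by
  have hM1 : ∀ y ∈ M, ‖y - x₀‖ ≤ 1 := fun y hy => by
    rw [← dist_eq_norm]
    exact (dist_le_diam_of_mem hM.isBounded hy hx₀).trans hdiam
  simp_rw [sg_smul_score_add hM hμ ht]
  have hsm : StronglyMeasurable fun z => (cc t / sg t) • postShift μ (cc t / sg t) x₀ z :=
    (stronglyMeasurable_postShift _ x₀).fun_const_smul _
  refine Integrable.of_bound (hsm.norm.measurable.pow_const 2).aestronglyMeasurable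
    (‖cc t / sg t‖ ^ 2) (ae_of_all _ fun z => ?_)
  rw [norm_pow, norm_norm, norm_smul]
  gcongr
  exact mul_le_of_le_one_right (norm_nonneg _) (norm_postShift_le_one hM hμ _ hM1 z)

/-- A bound for the second moment of the error of the score. -/
lemma integral_norm_score_sq_le [IsProbabilityMeasure μ] (hβ : 1 ≤ β)
    (hM : IsRegularManifold β d τmin τ LM M) (hp : HasRegularDensity α d τ pmin pmax Lμ M p μ)
    (hC : IsLogComplexity d τ LM Clog M p) (hdiam : Metric.diam M ≤ 1) {t : ℝ} (ht : 0 < t)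
    {x₀ : Amb D} (hx₀ : x₀ ∈ M) :
    ∫ z, ‖sg t • score μ t (fwd t x₀ z) + z‖ ^ 2 ∂(stdGaussian (Amb D)) ≤
      16 * (20 * d * (2 * logInvRatio t + 4 * Clog)) + 128 := by
  refine integral_le_of_exp_tail (integrable_norm_score_sq hM.isCompact (hp.ae_mem hM) hdiam ht hx₀)
    (by norm_num) fun v hv => ?_
  have hX := hC.le_dim_mul hM (L := 2 * logInvRatio t)
    (mul_nonneg zero_le_two (logInvRatio_nonneg t))
  -- The choice `δ = exp(-v / 128)` makes the squared threshold exceed its value at `δ = 1` by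
  -- exactly `16 · 8 · v / 128 = v`.
  refine (measure_mono fun z hz => ?_).trans (stdGaussian_score_tail_le hβ hM hp hC hdiam ht
    (Real.exp_pos (-v / 128)) (Real.exp_le_one_iff.2 (by linarith)) hx₀)
  refine lt_of_pow_lt_pow_left₀ 2 (norm_nonneg _) (lt_of_eq_of_lt ?_
    (show _ < ‖sg t • score μ t (fwd t x₀ z) + z‖ ^ 2 from hz))
  rw [← Real.exp_neg, Real.log_exp, mul_pow, Real.sq_sqrt (by linarith)]
  ring

end Concentration

end ScoreConcentration

theorem theorem4p3 (α β : ℕ) (hαβ : α + 1 ≤ β) :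
    ∃ K : ℝ, 0 < K ∧
      ∀ (D d : ℕ) (τmin τ LM pmin pmax Lμ Clog : ℝ)
        (M : Set (ScoreConcentration.Amb D)) (p : ScoreConcentration.Amb D → ℝ)
        (μ : Measure (ScoreConcentration.Amb D)),
        IsProbabilityMeasure μ →
        ScoreConcentration.IsRegularManifold β d τmin τ LM M →
        ScoreConcentration.HasRegularDensity α d τ pmin pmax Lμ M p μ →
        ScoreConcentration.IsLogComplexity d τ LM Clog M p →
        Metric.diam M ≤ 1 →
        ∀ t : ℝ, 0 < t →
          -- (i) concentration of the posterior around the starting point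
          (∀ δ η : ℝ, 0 < δ → 0 < η →
            ∀ᵐ x₀ ∂μ,
              ENNReal.ofReal (1 - δ) ≤
                stdGaussian (ScoreConcentration.Amb D)
                  {z | 1 - η ≤
                    ∫ y in {y | y ∈ M ∧ ‖y - x₀‖ ≤ ScoreConcentration.radius d Clog t δ η},
                      ScoreConcentration.posteriorDensity d M p t
                        (ScoreConcentration.fwd t x₀ z) y
                        ∂(μHE[d] : Measure (ScoreConcentration.Amb D))}) ∧
          -- (ii) high-probability bound on the score
          (∀ δ : ℝ, 0 < δ →
            ∀ᵐ x₀ ∂μ,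
              ENNReal.ofReal (1 - δ) ≤
                stdGaussian (ScoreConcentration.Amb D)
                  {z | ‖ScoreConcentration.sg t •
                          ScoreConcentration.score μ t (ScoreConcentration.fwd t x₀ z) + z‖ ≤
                    K * (4 * Real.sqrt
                      (20 * d * (2 * ScoreConcentration.logInvRatio t + 4 * Clog)
                        + 8 * Real.log δ⁻¹))}) ∧
          -- (iii) second moment bound, for every starting point on the manifold
          (∀ y ∈ M,
            Integrable (fun z => ‖ScoreConcentration.sg t •
                ScoreConcentration.score μ t (ScoreConcentration.fwd t y z) + z‖ ^ 2)
              (stdGaussian (ScoreConcentration.Amb D)) ∧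
            ∫ z, ‖ScoreConcentration.sg t •
                ScoreConcentration.score μ t (ScoreConcentration.fwd t y z) + z‖ ^ 2
                ∂(stdGaussian (ScoreConcentration.Amb D)) ≤
              K * (8 * (40 * d * ScoreConcentration.logInvRatio t + 80 * d * Clog + 3))) := by
  -- Part (ii) needs only `K ≥ 1`. In (iii), comparing `640 d L + 1280 d Clog + 128` with the
  -- right-hand side term by term needs `24 K ≥ 128`.
  refine ⟨8, by norm_num, ?_⟩
  intro D d τmin τ LM pmin pmax Lμ Clog M p μ hμp hM hp hC hdiam t ht
  have hβ : 1 ≤ β := by omega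
  refine ⟨fun δ η hδ hη => ?_, fun δ hδ => ?_, fun y hy => ⟨?_, ?_⟩⟩
  · exact (hp.ae_mem hM).mono fun x₀ hx₀ =>
      ScoreConcentration.posterior_concentration hβ hM hp hC ht hδ hη hx₀
  · refine (hp.ae_mem hM).mono fun x₀ hx₀ => ?_
    rcases le_total 1 δ with hδ1 | hδ1
    · rw [ENNReal.ofReal_of_nonpos (by linarith)]
      exact zero_le
    · refine ScoreConcentration.ofReal_one_sub_le_of_compl_subset hδ.le (fun z hz => ?_)
        (ScoreConcentration.stdGaussian_score_tail_le hβ hM hp hC hdiam ht hδ hδ1 hx₀)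
      rw [Set.mem_compl_iff, Set.mem_ofPred, not_le] at hz
      exact lt_of_le_of_lt (le_mul_of_one_le_left (by positivity) (by norm_num)) hz
  · exact ScoreConcentration.integrable_norm_score_sq hM.isCompact (hp.ae_mem hM) hdiam ht hy
  · have hC0 : 0 < Clog := by
      linarith [(le_max_right (d : ℝ) 4).trans_lt hC.max_lt]
    have hL := ScoreConcentration.logInvRatio_nonneg t
    have h := ScoreConcentration.integral_norm_score_sq_le hβ hM hp hC hdiam ht hy
    have h1 : 0 ≤ d * ScoreConcentration.logInvRatio t := by positivity
    have h2 : 0 ≤ d * Clog := by positivity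
    linarith
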